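/- Let $n\ge 0$ and let $E^n\subset\mathbb{R}^{n+1}$ be the hyperplane of vectors with coordinate sum zero, with the Euclidean inner product inherited from $\mathbb{R}^{n+1}$ and the induced $n$-dimensional Euclidean volume $\mathrm{Vol}_n$ (a unit cube on an orthonormal basis of $E^n$ has volume $1$; for $n=0$ a point has volume $1$). Let $\alpha_i=\varepsilon_i-\varepsilon_{i+1}$ and let $\varpi_1,\dots,\varpi_n\in E^n$ be the fundamental weights, defined by $(\varpi_i,\alpha_j)=\delta_{ij}$. The symmetric group $\mathfrak{S}_{n+1}$ acts on $E^n$ by permuting coordinates, and for $\lambda\in E^n$ the permutohedron is $\mathsf{P}_n(\lambda)=\mathrm{Conv}(\mathfrak{S}_{n+1}\cdot\lambda)$. For $1\le i\le d$ put $$\Gamma'_{d,i}(x_1,x_2,\dots)=\frac{1}{d\sqrt{c_{d,i,i}}}\binom{d+1}{i}\sum_{j=1}^{d}c_{d,i,j}\,x_j,\qquad c_{d,i,j}=\min\{i,j\}-\frac{ij}{d+1},$$ where the $c_{d,i,j}$ are the entries of the inverse of the Cartan matrix of type $A_d$. For a polynomial $p$ and $u\ge0$ let $p[u](x_1,x_2,\dots)=p(x_{1+u},x_{2+u},\dots)$.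 An $n$-Dyck path is a lattice path from $(0,0)$ to $(n,n)$ with north steps $(0,1)$ and east steps $(1,0)$ that stays weakly above the diagonal $y=x$; let $\mathcal{D}_n$ be the set of all of them. For a north step $N$ of $D\in\mathcal{D}_n$ with initial point $(u,u')$, let $D_N$ be the part of $D$ from $(u,u')$ to $(n,n)$, translated by $-(u,u')$, and let $K$ be the (non-empty) set of integers $1\le k\le n-u$ such that $D_N$ passes through $(k,k)$ and its sub-path from $(0,0)$ to $(k,k)$ is a $k$-Dyck path. Put $\Gamma'_N=\Gamma'_{d,i}[u]$ with $d=\max K$ and $i=\min K$, and $\Gamma'_D=\prod_{N}\Gamma'_N$, the product over all north steps $N$ of $D$. Then for every $n\ge0$ there is a unique polynomial $\mathcal{V}_n\in\mathbb{R}[x_1,x_2,\dots]$ such that $$\mathcal{V}_n(x_1,x_2,\dots)=\mathrm{Vol}_n\bigl(\mathsf{P}_n(x_1\varpi_1+\cdots+x_n\varpi_n)\bigr)\quad\text{whenever } x_1,\dots,x_n\ge 0,$$ and $$\mathcal{V}_n=\sum_{D\in\mathcal{D}_n}\Gamma'_D .$$ -/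

import Mathlib

noncomputable section

namespace Permutohedron

/-! ### The root system of type `A_n` -/

/-- The Euclidean space `E`: the hyperplane of vectors of coordinate sum zero in `ℝ^(n+1)`,
with the inner product inherited from `ℝ^(n+1)`. -/
def E (n : ℕ) : Submodule ℝ (EuclideanSpace ℝ (Fin (n + 1))) where
  carrier := {v | ∑ k, v k = 0}
  zero_mem' := by simp
  add_mem' := by
    intro a b ha hb
    simp only [Set.mem_ofPred_eq, PiLp.add_apply, Finset.sum_add_distrib] at *
    rw [ha, hb, add_zero]
  smul_mem' := by
    intro c a ha
    simp only [Set.mem_ofPred_eq, PiLp.smul_apply, smul_eq_mul, ← Finset.mul_sum] at *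
    rw [ha, mul_zero]

/-- The simple root `α_{i+1} = ε_{i+1} - ε_{i+2}` (the index `i : Fin n` starts from `0`). -/
def simpleRoot (n : ℕ) (i : Fin n) : E n :=
  ⟨EuclideanSpace.single i.castSucc (1 : ℝ) - EuclideanSpace.single i.succ (1 : ℝ), by
    change ∑ k : Fin (n + 1), (EuclideanSpace.single i.castSucc (1 : ℝ) -
      EuclideanSpace.single i.succ (1 : ℝ)) k = 0
    simp⟩

/-- The fundamental weight `ϖ_{i+1}` (the index `i : Fin n` starts from `0`): the vector
`(1, …, 1, 0, …, 0) - (i+1)/(n+1) • (1, …, 1)` with `i + 1` leading ones. It is characterised in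
`eq_fundamentalWeight_iff` by `(ϖ_i, α_j) = δ_{ij}`. -/
def fundamentalWeight (n : ℕ) (i : Fin n) : E n :=
  ⟨WithLp.toLp 2 fun k : Fin (n + 1) =>
      (if (k : ℕ) ≤ i then 1 else 0) - ((i : ℝ) + 1) / ((n : ℝ) + 1), by
    have h : (Finset.univ.filter fun k : Fin (n + 1) => (k : ℕ) ≤ i) = Finset.Iic i.castSucc := by
      ext k; simp [Fin.le_def]
    have hn : (n : ℝ) + 1 ≠ 0 := by positivity
    change ∑ k : Fin (n + 1), ((if (k : ℕ) ≤ i then (1 : ℝ) else 0) - _) = 0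
    rw [Finset.sum_sub_distrib, Finset.sum_boole, h, Fin.card_Iic]
    simp
    field_simp
    ring⟩

theorem inner_simpleRoot (n : ℕ) (v : E n) (j : Fin n) :
    inner ℝ v (simpleRoot n j) = v.1 j.castSucc - v.1 j.succ := by
  simp [simpleRoot, Submodule.coe_inner, inner_sub_right, EuclideanSpace.inner_single_right]

/-- The fundamental weights are the vectors of `E` with `(ϖ_i, α_j) = δ_{ij}`. -/
theorem eq_fundamentalWeight_iff (n : ℕ) (i : Fin n) (v : E n) :
    v = fundamentalWeight n i ↔
      ∀ j, inner ℝ v (simpleRoot n j) = if i = j then (1 : ℝ) else 0 := by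
  have key : ∀ j, inner ℝ (fundamentalWeight n i) (simpleRoot n j)
      = if i = j then (1 : ℝ) else 0 := by
    intro j
    rw [inner_simpleRoot]
    simp only [fundamentalWeight, Fin.val_castSucc, Fin.val_succ, Fin.ext_iff]
    split_ifs <;> first | omega | simp
  refine ⟨fun h => h ▸ key, fun h => ?_⟩
  rw [← sub_eq_zero]
  set w := v - fundamentalWeight n i with hw
  have hroot : ∀ j : Fin n, w.1 j.castSucc = w.1 j.succ := by
    intro j
    have : inner ℝ w (simpleRoot n j) = (0 : ℝ) := by
      rw [hw, inner_sub_left, h, key, sub_self]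
    rw [inner_simpleRoot] at this
    linarith
  have hconst : ∀ k : Fin (n + 1), w.1 k = w.1 0 := by
    intro k
    induction k using Fin.induction with
    | zero => rfl
    | succ j ih => rw [← hroot, ih]
  have hsum : ∑ k, w.1 k = 0 := w.2
  rw [Finset.sum_congr rfl fun k _ => hconst k] at hsum
  have h0 : w.1 0 = 0 := by
    have hn : (n : ℝ) + 1 ≠ 0 := by positivity
    simpa [hn] using hsum
  ext k
  simp [hconst k, h0]

/-! ### The permutohedron and its volume -/

/-- The orbit of `v` under the Weyl group `S_{n+1}`, which permutes the coordinates. -/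
def weylOrbit (n : ℕ) (v : E n) : Set (E n) :=
  {w | ∃ σ : Equiv.Perm (Fin (n + 1)), ∀ k, w.1 k = v.1 (σ k)}

/-- The permutohedron `P_n(v) = Conv(S_{n+1} · v)`, a subset of `E`. -/
def permutohedron (n : ℕ) (v : E n) : Set (E n) :=
  convexHull ℝ (weylOrbit n v)

/-- The `n`-dimensional Euclidean volume on `E`: the translation invariant measure for which the
unit cube of an orthonormal basis of `E` has volume `1`. -/
def vol (n : ℕ) : MeasureTheory.Measure (E n) :=
  (stdOrthonormalBasis ℝ (E n)).toBasis.addHaar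

/-- `V` is the volume polynomial `𝒱_n`. We work in the polynomial ring `ℝ[x_1, x_2, …]`, with the
variable `x_{j+1}` written `MvPolynomial.X j`; the condition is
`V(x_1, x_2, …) = Vol_n(P_n(x_1 ϖ_1 + ⋯ + x_n ϖ_n))` for all `x_1, …, x_n ≥ 0`. -/
def IsVolumePolynomial (n : ℕ) (V : MvPolynomial ℕ ℝ) : Prop :=
  ∀ x : ℕ → ℝ, (∀ j < n, 0 ≤ x j) →
    MvPolynomial.eval x V =
      (vol n (permutohedron n (∑ i : Fin n, x i • fundamentalWeight n i))).toReal

/-! ### The `Γ`-polynomials -/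

/-- The coefficient `c_{d,i,j} = min{i,j} - ij/(d+1)`, for `1 ≤ i, j ≤ d`: the entry `(i,j)` of the
inverse of the Cartan matrix of type `A_d` (see `cartan_mul_cartanInv`). -/
def cartanInv (d i j : ℕ) : ℝ :=
  (min i j : ℕ) - (i * j : ℝ) / (d + 1)

theorem cartan_mul_cartanInv (d : ℕ) :
    (CartanMatrix.A d).map (Int.cast : ℤ → ℝ) *
      Matrix.of (fun i j : Fin d => cartanInv d (i + 1) (j + 1)) = 1 := by
  ext i k
  obtain ⟨i, hi⟩ := i
  obtain ⟨k, hk⟩ := k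
  have hd : (d : ℝ) + 1 ≠ 0 := by positivity
  have h0 : cartanInv d 0 (k + 1) = 0 := by simp [cartanInv]
  have h1 : cartanInv d (d + 1) (k + 1) = 0 := by
    simp only [cartanInv, Nat.min_eq_right (show k + 1 ≤ d + 1 by omega)]
    push_cast
    field_simp
    ring
  have hsum : ∑ j : Fin d, ((CartanMatrix.A d ⟨i, hi⟩ j : ℤ) : ℝ) * cartanInv d (j + 1) (k + 1) =
      2 * cartanInv d (i + 1) (k + 1) - cartanInv d i (k + 1) - cartanInv d (i + 2) (k + 1) := by
    have hA : ∀ j : Fin d, ((CartanMatrix.A d ⟨i, hi⟩ j : ℤ) : ℝ) * cartanInv d (j + 1) (k + 1) =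
        (if (j : ℕ) = i then 2 * cartanInv d (j + 1) (k + 1) else 0) -
        (if (j : ℕ) + 1 = i then cartanInv d (j + 1) (k + 1) else 0) -
        (if (j : ℕ) = i + 1 then cartanInv d (j + 1) (k + 1) else 0) := by
      intro j
      simp only [CartanMatrix.A, Matrix.of_apply, Fin.ext_iff]
      split_ifs <;> first | omega | simp
    rw [Finset.sum_congr rfl fun j _ => hA j, Finset.sum_sub_distrib, Finset.sum_sub_distrib]
    have e1 := Fin.sum_univ_eq_sum_range
      (fun j => if j = i then 2 * cartanInv d (j + 1) (k + 1) else 0) d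
    have e2 := Fin.sum_univ_eq_sum_range
      (fun j => if j + 1 = i then cartanInv d (j + 1) (k + 1) else 0) d
    have e3 := Fin.sum_univ_eq_sum_range
      (fun j => if j = i + 1 then cartanInv d (j + 1) (k + 1) else 0) d
    rw [e1, e2, e3]
    rw [Finset.sum_ite_eq', Finset.sum_ite_eq']
    have e4 : ∑ j ∈ Finset.range d, (if j + 1 = i then cartanInv d (j + 1) (k + 1) else 0) =
        cartanInv d i (k + 1) := by
      cases i with
      | zero => simp [h0]
      | succ i =>
        simp only [Nat.add_right_cancel_iff]
        rw [Finset.sum_ite_eq']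
        simp [show i < d by omega]
    rw [e4]
    simp only [Finset.mem_range, hi, if_true]
    split_ifs with h
    · rfl
    · have : i + 2 = d + 1 := by omega
      rw [this, h1]
  rw [Matrix.mul_apply]
  simp only [Matrix.map_apply, Matrix.of_apply]
  rw [hsum, Matrix.one_apply]
  simp only [Fin.mk.injEq, cartanInv]
  rcases lt_trichotomy i k with h | h | h
  · rw [if_neg h.ne, Nat.min_eq_left (by omega), Nat.min_eq_left (by omega),
      Nat.min_eq_left (by omega)]
    push_cast
    ring
  · subst h
    rw [if_pos rfl, Nat.min_eq_left (by omega), Nat.min_eq_left (by omega),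
      Nat.min_eq_right (by omega)]
    push_cast
    ring
  · rw [if_neg h.ne', Nat.min_eq_right (by omega), Nat.min_eq_right (by omega),
      Nat.min_eq_right (by omega)]
    push_cast
    ring

/-- The linear form
`Γ'_{d,i} = 1/(d √c_{d,i,i}) * binom(d+1, i) * ∑_{j=1}^d c_{d,i,j} x_j`, for `1 ≤ i ≤ d`
(recall that `MvPolynomial.X j` is the variable `x_{j+1}`). -/
def gamma (d i : ℕ) : MvPolynomial ℕ ℝ :=
  MvPolynomial.C (1 / (d * √(cartanInv d i i)) * ((d + 1).choose i : ℝ)) *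
    ∑ j ∈ Finset.range d, MvPolynomial.C (cartanInv d i (j + 1)) * MvPolynomial.X j

/-- The shift `p[u](x_1, x_2, …) = p(x_{1+u}, x_{2+u}, …)`. -/
def shift (u : ℕ) (p : MvPolynomial ℕ ℝ) : MvPolynomial ℕ ℝ :=
  MvPolynomial.rename (fun j => j + u) p

/-! ### Dyck paths

An `n`-Dyck path is a Mathlib Dyck word of semilength `n`: the letter `U` is a north step `(0,1)` and
the letter `D` an east step `(1,0)`. -/

/-- The set `𝒟_n` of `n`-Dyck paths. -/
abbrev DyckPath (n : ℕ) : Type := {D : DyckWord // D.semilength = n}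

/-- The positions `t` of the north steps in the list of steps of `D`. -/
def northSteps {n : ℕ} (D : DyckPath n) : Finset ℕ :=
  (Finset.range D.1.toList.length).filter fun t => D.1.toList[t]? = some DyckStep.U

/-- The first coordinate `u` of the initial point of the step of `D` at position `t`: the number
of east steps before it. -/
def startX {n : ℕ} (D : DyckPath n) (t : ℕ) : ℕ :=
  (D.1.toList.take t).count DyckStep.D

/-- The set `K` of all `k` with `1 ≤ k ≤ n - u` such that the part of `D` from the step at position
`t` on, translated to the origin, passes through `(k,k)` and is a `k`-Dyck path up to there. -/
def returns {n : ℕ} (D : DyckPath n) (t : ℕ) : Set ℕ :=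
  {k | 1 ≤ k ∧ k + startX D t ≤ n ∧
    ∃ Q : DyckPath k, Q.1.toList = (D.1.toList.drop t).take (2 * k)}

theorem bddAbove_returns {n : ℕ} (D : DyckPath n) (t : ℕ) : BddAbove (returns D t) :=
  ⟨n, fun _ hk => (Nat.le_add_right _ _).trans hk.2.1⟩

theorem returns_nonempty {n : ℕ} (D : DyckPath n) {t : ℕ} (ht : t ∈ northSteps D) :
    (returns D t).Nonempty := by
  obtain ⟨htl, htU⟩ := Finset.mem_filter.1 ht
  rw [Finset.mem_range] at htl
  set L := D.1.toList.drop t with hL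
  have hU := congrArg (List.count DyckStep.U) (List.take_append_drop t D.1.toList)
  have hD := congrArg (List.count DyckStep.D) (List.take_append_drop t D.1.toList)
  rw [List.count_append, ← hL] at hU hD
  have hpre := D.1.count_D_le_count_U t
  have htot := D.1.count_U_eq_count_D
  have hn : D.1.toList.count DyckStep.U = n := D.2
  have hL0 : L[0]? = some DyckStep.U := by rw [hL, List.getElem?_drop]; simpa using htU
  have hLlen : 1 ≤ L.length := by rw [hL, List.length_drop]; omega
  have hex : ∃ m, 1 ≤ m ∧ (L.take m).count DyckStep.U ≤ (L.take m).count DyckStep.D :=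
    ⟨L.length, hLlen, by rw [List.take_length]; omega⟩
  classical
  set m := Nat.find hex with hm
  obtain ⟨hm1, hmle⟩ := Nat.find_spec hex
  rw [← hm] at hm1 hmle
  have hmin : ∀ j < m, (L.take j).count DyckStep.D ≤ (L.take j).count DyckStep.U := by
    intro j hj
    rcases Nat.eq_zero_or_pos j with rfl | hj0
    · simp
    · have := Nat.find_min hex hj
      by_contra hcon
      exact this ⟨hj0, by omega⟩
  have hstep : (L.take m).count DyckStep.D ≤ (L.take (m - 1)).count DyckStep.D + 1 ∧
      (L.take (m - 1)).count DyckStep.U ≤ (L.take m).count DyckStep.U := by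
    have : m = (m - 1) + 1 := by omega
    rw [this, List.take_add_one, List.count_append, List.count_append]
    refine ⟨?_, by simp⟩
    rw [Nat.add_sub_cancel]
    have h1 : (L[m - 1]?.toList).count DyckStep.D ≤ (L[m - 1]?.toList).length :=
      List.count_le_length
    have h2 : (L[m - 1]?.toList).length ≤ 1 := by cases L[m - 1]? <;> simp
    omega
  have hm2 : m ≠ 1 := by
    intro h
    rw [h, show (1 : ℕ) = 0 + 1 from rfl, List.take_add_one, hL0] at hmle
    simp at hmle
  have hprev : (L.take (m - 1)).count DyckStep.D < (L.take (m - 1)).count DyckStep.U := by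
    have := Nat.find_min hex (m := m - 1) (by omega)
    by_contra hcon
    exact this ⟨by omega, by omega⟩
  have heq : (L.take m).count DyckStep.U = (L.take m).count DyckStep.D := by omega
  let Q : DyckWord := ⟨L.take m, heq, fun j => by
    rw [List.take_take]
    rcases lt_or_ge j m with h | h
    · rw [min_eq_left h.le]; exact hmin j h
    · rw [min_eq_right h]; exact heq.ge⟩
  have hmL : m ≤ L.length := Nat.find_min' hex ⟨hLlen, by rw [List.take_length]; omega⟩
  have hQ := Q.two_mul_semilength_eq_length
  have hQlen : Q.toList.length = m := by simp [Q, hmL]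
  refine ⟨Q.semilength, by omega, ?_, ⟨Q, rfl⟩, ?_⟩
  · have h1 : Q.semilength = (L.take m).count DyckStep.D := Q.semilength_eq_count_D
    have h2 : (L.take m).count DyckStep.D ≤ L.count DyckStep.D :=
      (List.take_sublist m L).count_le _
    unfold startX
    omega
  · rw [hQ, hQlen]

/-- The polynomial `Γ'_N = Γ'_{d,i}[u]` of the north step `N` of `D` at position `t`, where
`d = max K` and `i = min K` (`K` is bounded and, for a north step, non-empty). -/
def gammaStep {n : ℕ} (D : DyckPath n) (t : ℕ) : MvPolynomial ℕ ℝ :=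
  shift (startX D t) (gamma (sSup (returns D t)) (sInf (returns D t)))

/-- The polynomial `Γ'_D`, the product of the `Γ'_N` over all north steps `N` of `D`. -/
def gammaPath {n : ℕ} (D : DyckPath n) : MvPolynomial ℕ ℝ :=
  ∏ t ∈ northSteps D, gammaStep D t

end Permutohedron

end

noncomputable section

namespace Permutohedron

open Finset MeasureTheory

/-! ### The recursive volume of a block -/

/-! Encode a weight by the partial sums `P` of its decreasing coordinates. A facet of its
permutohedron comes from a proper nonempty set of `i` coordinates; it is a product of the
permutohedra of the two blocks into which `i` cuts `P`, and its distance from the centre is a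
multiple of `height`. Summing pyramids over the facets suggests a volume recursion, and `blockVol`
is its solution with the factorials, binomials and square roots normalised away.

The sum over Dyck paths obeys the same recursion. In the first-return decomposition `A.nest + B`,
the first north step has `d` equal to the full semilength and `i` equal to the first return, and the
other steps see only `A` or only `B`. The linear form of the first step evaluates to a constant
times `height`, because the inverse Cartan matrix inverts second differences. This gives
`eval_dyckSum`.

It remains to see that `blockVol` measures the polytope. No pyramids are constructed; Fubini is used
instead. By Rado's description (`convexHull_rearrangements`) the permutohedron is cut out by
majorization. If its first coordinate is fixed at `t`, between two consecutive terms, the slice is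
the permutohedron of the sequence in which those two terms are replaced by their sum minus `t`
(`cons_mem_majPolytope_iff`). So the volume is an integral of smaller volumes, and
`sum_sliceIntegral` is the matching identity for `blockVol`. It rests on the first variation formula
`hasDerivAt_blockVol`. Projecting along the last coordinate divides the Euclidean volume by `√(n +
1)`, and polynomials are determined by their values on an orthant. -/

/-- The support function at `i` of the block `[a, b]` of the sequence `P` of partial sums. -/
def height (P : ℕ → ℝ) (a b i : ℕ) : ℝ :=
  P i - P a - ((i : ℝ) - a) / ((b : ℝ) - a) * (P b - P a)

/-- The normalised volume of the permutohedron of the block `[a, b]` of the sequence `P` of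
partial sums, defined by the pyramid decomposition over the facets. -/
def blockVol (P : ℕ → ℝ) (a b : ℕ) : ℝ :=
  if b ≤ a + 1 then 1 else
    ((b : ℝ) - a - 1)⁻¹ * ∑ i : Finset.Ioo a b, height P a b i * blockVol P a i * blockVol P i b
termination_by b - a
decreasing_by
  all_goals
    have := Finset.mem_Ioo.1 i.2
    omega

theorem blockVol_of_le (P : ℕ → ℝ) {a b : ℕ} (h : b ≤ a + 1) : blockVol P a b = 1 := by
  rw [blockVol, if_pos h]

theorem blockVol_eq (P : ℕ → ℝ) {a b : ℕ} (h : a + 1 < b) :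
    blockVol P a b = ((b : ℝ) - a - 1)⁻¹ *
      ∑ i ∈ Ioo a b, height P a b i * blockVol P a i * blockVol P i b := by
  rw [blockVol, if_neg (by omega)]
  congr 1
  exact Finset.sum_coe_sort (Ioo a b)
    fun i => height P a b i * blockVol P a i * blockVol P i b

theorem sum_height_mul_blockVol (P : ℕ → ℝ) {a b : ℕ} (h : a < b) :
    ∑ i ∈ Ioo a b, height P a b i * blockVol P a i * blockVol P i b =
      ((b : ℝ) - a - 1) * blockVol P a b := by
  rcases Nat.lt_or_ge (a + 1) b with h' | h'
  · rw [blockVol_eq P h', mul_inv_cancel_left₀]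
    have : (a : ℝ) + 1 < b := by exact_mod_cast h'
    linarith
  · obtain rfl : b = a + 1 := by omega
    have : Ioo a (a + 1) = ∅ := by ext; simp
    simp [this]

theorem height_congr {P P' : ℕ → ℝ} {s : ℕ} {c : ℝ} {a b i : ℕ} (ha : P' (a + s) = P a + c)
    (hb : P' (b + s) = P b + c) (hi : P' (i + s) = P i + c) :
    height P' (a + s) (b + s) (i + s) = height P a b i := by
  simp only [height, ha, hb, hi]
  push_cast
  ring

/-- Only differences of `P` and of indices enter the recursion, so a translation of the index and an
additive constant drop out. On a block to the right of the cut, a slice is such a translation. -/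
theorem blockVol_congr {P P' : ℕ → ℝ} {s : ℕ} {c : ℝ} {a b : ℕ}
    (h : ∀ j, a ≤ j → j ≤ b → P' (j + s) = P j + c) :
    blockVol P' (a + s) (b + s) = blockVol P a b := by
  induction hd : b - a using Nat.strong_induction_on generalizing a b with
  | _ d ih =>
    rcases Nat.lt_or_ge (a + 1) b with hlt | hle
    · rw [blockVol_eq P hlt, blockVol_eq P' (by omega), ← map_add_right_Ioo, sum_map]
      push_cast
      congr 1
      · ring
      refine sum_congr rfl fun i hi => ?_
      rw [mem_Ioo] at hi
      rw [addRightEmbedding_apply, height_congr (h a le_rfl (by omega)) (h b (by omega) le_rfl)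
        (h i (by omega) (by omega)),
        ih (i - a) (by omega) (fun j h1 h2 => h j h1 (by omega)) rfl,
        ih (b - i) (by omega) (fun j h1 h2 => h j (by omega) h2) rfl]
    · rw [blockVol_of_le _ hle, blockVol_of_le _ (by omega)]

theorem blockVol_congr_of_eq {P P' : ℕ → ℝ} {a b : ℕ} (h : ∀ j, a ≤ j → j ≤ b → P' j = P j) :
    blockVol P' a b = blockVol P a b :=
  blockVol_congr (s := 0) (c := 0) fun j h1 h2 => by simpa using h j h1 h2

/-! ### The derivative of the recursive volume -/

/-- Both sides run over the codimension-two faces, given by two cuts `l < i`. Each face is reached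
twice: by cutting at `i` first, or at `l` first. -/
theorem sum_height_pair (X Y : ℕ → ℝ) (w : ℕ → ℕ → ℝ) (a b : ℕ) :
    ∑ i ∈ Ioo a b, height X a b i *
        ((∑ l ∈ Ioo a i, height Y a i l * w a l * w l i) * w i b +
          w a i * ∑ l ∈ Ioo i b, height Y i b l * w i l * w l b) =
      ∑ i ∈ Ioo a b, ∑ l ∈ Ioo a i,
        (height X a b i * height Y a i l + height X a b l * height Y l b i) *
          (w a l * w l i * w i b) := by
  have hcomm : ∑ i ∈ Ioo a b, ∑ l ∈ Ioo i b,
        height X a b i * height Y i b l * (w a i * w i l * w l b) =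
      ∑ l ∈ Ioo a b, ∑ i ∈ Ioo a l,
        height X a b i * height Y i b l * (w a i * w i l * w l b) :=
    sum_comm' fun i l => by simp only [mem_Ioo]; omega
  simp only [add_mul, sum_add_distrib]
  rw [← hcomm, ← sum_add_distrib]
  refine sum_congr rfl fun i _ => ?_
  rw [mul_add, sum_mul, mul_sum, mul_sum, mul_sum]
  congr 1 <;> refine sum_congr rfl fun l _ => by ring

/-- Expressed through heights in the large block, each nested height is the height at its own cut
minus a multiple of the height at the other cut. The mixed terms then form a symmetric pair, and the
remaining terms are products at a single cut. -/
theorem height_pair_symm (X Y : ℕ → ℝ) {a b i l : ℕ} (hal : a < l) (hli : l < i) (hib : i < b) :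
    height X a b i * height Y a i l + height X a b l * height Y l b i =
      height Y a b i * height X a i l + height Y a b l * height X l b i := by
  have h1 : (a : ℝ) < l := by exact_mod_cast hal
  have h2 : (l : ℝ) < i := by exact_mod_cast hli
  have h3 : (i : ℝ) < b := by exact_mod_cast hib
  have hai : (i : ℝ) - a ≠ 0 := by intro h; linarith
  have hlb : (b : ℝ) - l ≠ 0 := by intro h; linarith
  have hab : (b : ℝ) - a ≠ 0 := by intro h; linarith
  have e1 : ∀ Z : ℕ → ℝ, height Z a i l =
      height Z a b l - ((l : ℝ) - a) / (i - a) * height Z a b i := by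
    intro Z; simp only [height]; field_simp; ring
  have e2 : ∀ Z : ℕ → ℝ, height Z l b i =
      height Z a b i - ((b : ℝ) - i) / (b - l) * height Z a b l := by
    intro Z; simp only [height]; field_simp; ring
  rw [e1, e2, e1, e2]
  ring

/-- This is the first variation of volume: each facet contributes its own volume times its
displacement. Differentiating the recursion also produces derivatives of the facet volumes; the
symmetry over codimension-two faces turns these into further copies of the same sum. -/
theorem hasDerivAt_blockVol {γ : ℝ → ℕ → ℝ} {Q : ℕ → ℝ} {t : ℝ}
    (hγ : ∀ j, HasDerivAt (fun s => γ s j) (Q j) t) {a b : ℕ} (hab : a < b) :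
    HasDerivAt (fun s => blockVol (γ s) a b)
      (∑ i ∈ Ioo a b, height Q a b i * blockVol (γ t) a i * blockVol (γ t) i b) t := by
  induction hd : b - a using Nat.strong_induction_on generalizing a b with
  | _ d ih =>
    rcases Nat.lt_or_ge (a + 1) b with hlt | hle
    · have hh : ∀ i, HasDerivAt (fun s => height (γ s) a b i) (height Q a b i) t := fun i =>
        ((hγ i).sub (hγ a)).sub (((hγ b).sub (hγ a)).const_mul _)
      have hsum := (HasDerivAt.fun_sum fun i (hi : i ∈ Ioo a b) =>
        ((hh i).mul (ih (i - a) (by rw [mem_Ioo] at hi; omega) (mem_Ioo.1 hi).1 rfl)).mul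
          (ih (b - i) (by rw [mem_Ioo] at hi; omega) (mem_Ioo.1 hi).2 rfl)).const_mul
          ((b : ℝ) - a - 1)⁻¹
      have hne : (b : ℝ) - a - 1 ≠ 0 := by
        have : (a : ℝ) + 1 < b := by exact_mod_cast hlt
        intro h; linarith
      refine (hsum.congr_deriv ?_).congr_of_eventuallyEq
        (Filter.Eventually.of_forall fun s => blockVol_eq (γ s) hlt)
      rw [inv_mul_eq_iff_eq_mul₀ hne]
      have hsymm := sum_height_pair (γ t) Q (blockVol (γ t)) a b
      have hsymm' := sum_height_pair Q (γ t) (blockVol (γ t)) a b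
      rw [sum_congr rfl fun i hi => sum_congr rfl fun l hl => by
        rw [height_pair_symm (γ t) Q (mem_Ioo.1 hl).1 (mem_Ioo.1 hl).2 (mem_Ioo.1 hi).2],
        ← hsymm'] at hsymm
      -- The inner sums contribute `(i - a - 1) + (b - i - 1) = b - a - 2` copies of the desired
      -- sum; differentiating `height` itself supplies the last of the `b - a - 1` copies.
      have hP : ∀ i ∈ Ioo a b, height Q a b i *
          ((∑ l ∈ Ioo a i, height (γ t) a i l * blockVol (γ t) a l * blockVol (γ t) l i) *
              blockVol (γ t) i b +
            blockVol (γ t) a i *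
              ∑ l ∈ Ioo i b, height (γ t) i b l * blockVol (γ t) i l * blockVol (γ t) l b) =
          ((b : ℝ) - a - 1) * (height Q a b i * blockVol (γ t) a i * blockVol (γ t) i b) -
            height Q a b i * blockVol (γ t) a i * blockVol (γ t) i b := by
        intro i hi
        rw [sum_height_mul_blockVol _ (mem_Ioo.1 hi).1, sum_height_mul_blockVol _ (mem_Ioo.1 hi).2]
        ring
      rw [sum_congr rfl hP, sum_sub_distrib, ← mul_sum] at hsymm
      rw [eq_sub_iff_add_eq] at hsymm
      rw [← hsymm, ← sum_add_distrib]
      refine sum_congr rfl fun i _ => ?_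
      simp only [Pi.mul_apply]
      ring
    · have : Ioo a b = ∅ := by ext; simp; omega
      rw [this, sum_empty]
      refine (hasDerivAt_const t (1 : ℝ)).congr_of_eventuallyEq
        (Filter.Eventually.of_forall fun s => blockVol_of_le _ hle)

/-! ### Slices -/

/-- The partial sums of the sequence obtained from the one with partial sums `P` by replacing its
`k`-th and `k+1`-st terms by their sum minus `t`. -/
def slice (k : ℕ) (t : ℝ) (P : ℕ → ℝ) : ℕ → ℝ :=
  fun j => if j < k then P j else P (j + 1) - t

theorem hasDerivAt_slice (k : ℕ) (P : ℕ → ℝ) (t : ℝ) (j : ℕ) :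
    HasDerivAt (fun s => slice k s P j) (if j < k then 0 else -1) t := by
  unfold slice
  split_ifs
  · exact hasDerivAt_const _ _
  · simpa using (hasDerivAt_id t).const_sub (P (j + 1))

/-- When `t` is the term shared by the two adjacent ranges of slices, both slices simply delete that
term. This makes the boundary terms telescope. -/
theorem slice_succ (k : ℕ) (P : ℕ → ℝ) :
    slice (k + 1) (P (k + 1) - P k) P = slice k (P (k + 1) - P k) P := by
  ext j
  simp only [slice]
  split_ifs with h1 h2 h2
  · rfl
  · obtain rfl : j = k := by omega
    ring
  · omega
  · rfl

theorem blockVol_slice_of_le {k : ℕ} (t : ℝ) (P : ℕ → ℝ) {a b : ℕ} (h : b < k) :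
    blockVol (slice k t P) a b = blockVol P a b :=
  blockVol_congr_of_eq fun j _ hj => if_pos (by omega)

theorem blockVol_slice_of_ge {k : ℕ} (t : ℝ) (P : ℕ → ℝ) {a b : ℕ} (h : k ≤ a) :
    blockVol (slice k t P) a b = blockVol P (a + 1) (b + 1) :=
  (blockVol_congr (c := t) fun j hj _ => by simp [slice, show ¬ j < k by omega]).symm

theorem continuous_blockVol_slice (k : ℕ) (P : ℕ → ℝ) (a b : ℕ) :
    Continuous fun t => blockVol (slice k t P) a b := by
  rcases Nat.lt_or_ge a b with h | h
  · exact continuous_iff_continuousAt.2 fun t =>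
      (hasDerivAt_blockVol (hasDerivAt_slice k P t) h).continuousAt
  · simpa only [blockVol_of_le _ (show b ≤ a + 1 by omega)] using continuous_const

/-- The integral of the recursive volume over the `k`-th range of slices. -/
def sliceIntegral (P : ℕ → ℝ) (k a b : ℕ) : ℝ :=
  ∫ t in (P (k + 1) - P k)..(P k - P (k - 1)), blockVol (slice k t P) a b

/-- Integrate the derivative of `t * blockVol (slice k t P) a c`. Since heights are affine in `t`,
the recursion and the first variation formula together eliminate the part linear in `t`. In each
remaining product one of the two blocks avoids the cut `k`, hence is constant in `t` and leaves the
integral. -/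
theorem sliceIntegral_eq (P : ℕ → ℝ) {k a c : ℕ} (hak : a < k) (hkc : k ≤ c) :
    ((c : ℝ) - a) * sliceIntegral P k a c =
      (P k - P (k - 1)) * blockVol (slice k (P k - P (k - 1)) P) a c -
        (P (k + 1) - P k) * blockVol (slice k (P (k + 1) - P k) P) a c +
      ∑ i ∈ Ioo a c, (if i < k then
        (P i - P a - ((i : ℝ) - a) / ((c : ℝ) - a) * (P (c + 1) - P a)) *
          (blockVol P a i * sliceIntegral P k i c) else
        (P (i + 1) - P a - ((i : ℝ) - a) / ((c : ℝ) - a) * (P (c + 1) - P a)) *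
          (blockVol P (i + 1) (c + 1) * sliceIntegral P k a i)) := by
  have hac : a < c := by omega
  set Q : ℕ → ℝ := fun j => if j < k then 0 else -1
  have hlin : ∀ t i, height (slice k t P) a c i =
      height (slice k 0 P) a c i + t * height Q a c i := by
    intro t i
    have : ∀ j, slice k t P j = slice k 0 P j + t * Q j := by
      intro j; simp only [slice, Q]; split_ifs <;> ring
    simp only [height, this]
    ring
  have hder : ∀ t, HasDerivAt (fun s => s * blockVol (slice k s P) a c)
      (((c : ℝ) - a) * blockVol (slice k t P) a c - ∑ i ∈ Ioo a c, height (slice k 0 P) a c i *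
        (blockVol (slice k t P) a i * blockVol (slice k t P) i c)) t := by
    intro t
    refine ((hasDerivAt_id t).mul
      (hasDerivAt_blockVol (hasDerivAt_slice k P t) hac)).congr_deriv ?_
    have h := sum_height_mul_blockVol (slice k t P) hac
    rw [sum_congr rfl fun i _ => by rw [hlin t i, add_mul, add_mul, mul_assoc, mul_assoc t,
      mul_assoc t], sum_add_distrib, ← mul_sum] at h
    change 1 * blockVol (slice k t P) a c + t * ∑ i ∈ Ioo a c, height Q a c i *
      blockVol (slice k t P) a i * blockVol (slice k t P) i c = _
    linarith
  have hcont := fun i j => continuous_blockVol_slice k P i j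
  have hprod : ∀ i, Continuous fun t => height (slice k 0 P) a c i *
      (blockVol (slice k t P) a i * blockVol (slice k t P) i c) := fun i =>
    ((hcont a i).mul (hcont i c)).const_mul _
  have hint := intervalIntegral.integral_eq_sub_of_hasDerivAt
    (a := P (k + 1) - P k) (b := P k - P (k - 1)) (fun t _ => hder t) (by
      exact (((hcont a c).const_mul _).sub
        (continuous_finsetSum _ fun i _ => hprod i)).intervalIntegrable _ _)
  rw [intervalIntegral.integral_sub
    ((hcont a c).const_mul _ |>.intervalIntegrable _ _)
    ((continuous_finsetSum _ fun i _ => hprod i).intervalIntegrable _ _),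
    intervalIntegral.integral_const_mul, intervalIntegral.integral_finsetSum
      fun i _ => (hprod i).intervalIntegrable _ _,
    sub_eq_iff_eq_add] at hint
  rw [sliceIntegral, hint]
  congr 1
  refine sum_congr rfl fun i hi => ?_
  rw [mem_Ioo] at hi
  rw [intervalIntegral.integral_const_mul]
  have ha : slice k 0 P a = P a := if_pos hak
  have hc : slice k 0 P c = P (c + 1) := by simp [slice, hkc]
  simp only [height, ha, hc]
  split_ifs with hik
  · have hi' : slice k 0 P i = P i := if_pos hik
    simp only [blockVol_slice_of_le _ P hik, hi']
    rw [intervalIntegral.integral_const_mul, sliceIntegral]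
  · have hi' : slice k 0 P i = P (i + 1) := by simp [slice, hik]
    simp only [blockVol_slice_of_ge _ P (not_lt.1 hik), hi']
    rw [intervalIntegral.integral_mul_const, sliceIntegral]
    ring

theorem sum_Ioo_succ_telescope (e : ℕ → ℝ) {a c : ℕ} (h : a ≤ c) :
    ∑ k ∈ Ioo a (c + 1), (e k - e (k + 1)) = e (a + 1) - e (c + 1) := by
  have hs : Ioo a (c + 1) = Ico (a + 1) (c + 1) := rfl
  rw [hs, Finset.sum_Ico_eq_sum_range]
  have := Finset.sum_range_sub' (fun j => e (a + 1 + j)) (c + 1 - (a + 1))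
  rw [show a + 1 + (c + 1 - (a + 1)) = c + 1 by omega] at this
  exact this

/-- Summing over `k` telescopes the boundary terms. After exchanging the sums, the integrals over
the shorter blocks are known by induction, and the facet recursion for the longer block appears. -/
theorem sum_sliceIntegral (P : ℕ → ℝ) {a c : ℕ} (hac : a < c) :
    ∑ k ∈ Ioo a (c + 1), sliceIntegral P k a c =
      ((c : ℝ) + 1 - a) * blockVol P a (c + 1) := by
  induction hd : c - a using Nat.strong_induction_on generalizing a c with
  | _ d ih =>
    have hne : (c : ℝ) - a ≠ 0 := by
      have : (a : ℝ) < c := by exact_mod_cast hac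
      intro h; linarith
    -- `A i` collects the `k` to the right of the cut `i`, and `B (i + 1)` those with `k ≤ i`: there
    -- a cut at `i` in the slice is a cut at `i + 1` in `P`. The terms `A c` and `B (a + 1)`,
    -- missing from the shifted ranges, cancel the boundary terms.
    set A : ℕ → ℝ := fun i => (P i - P a - ((i : ℝ) - a) / ((c : ℝ) - a) * (P (c + 1) - P a)) *
      (((c : ℝ) + 1 - i) * (blockVol P a i * blockVol P i (c + 1))) with hA
    set B : ℕ → ℝ := fun i =>
      (P i - P a - ((i : ℝ) - 1 - a) / ((c : ℝ) - a) * (P (c + 1) - P a)) *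
      (((i : ℝ) - a) * (blockVol P a i * blockVol P i (c + 1))) with hB
    have hkey : ((c : ℝ) - a) * ∑ k ∈ Ioo a (c + 1), sliceIntegral P k a c =
        (P (a + 1) - P a) * blockVol P (a + 1) (c + 1) - (P (c + 1) - P c) * blockVol P a c +
        (∑ i ∈ Ioo a c, A i + ∑ i ∈ Ioo a c, B (i + 1)) := by
      rw [mul_sum, sum_congr rfl fun k hk => sliceIntegral_eq P (mem_Ioo.1 hk).1
        (Nat.le_of_lt_succ (mem_Ioo.1 hk).2), sum_add_distrib]
      congr 1
      · have htel := sum_Ioo_succ_telescope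
          (fun k => (P k - P (k - 1)) * blockVol (slice k (P k - P (k - 1)) P) a c) hac.le
        simp only [add_tsub_cancel_right, slice_succ] at htel
        rw [htel, blockVol_slice_of_ge _ _ le_rfl, ← slice_succ,
          blockVol_slice_of_le _ _ (Nat.lt_succ_self c)]
      · rw [sum_comm, ← sum_add_distrib]
        refine sum_congr rfl fun i hi => ?_
        rw [mem_Ioo] at hi
        rw [sum_ite, ← mul_sum, ← mul_sum, ← mul_sum, ← mul_sum]
        have h1 : {k ∈ Ioo a (c + 1) | i < k} = Ioo i (c + 1) := by
          ext; simp only [mem_filter, mem_Ioo]; omega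
        have h2 : {k ∈ Ioo a (c + 1) | ¬ i < k} = Ioo a (i + 1) := by
          ext; simp only [mem_filter, mem_Ioo]; omega
        rw [h1, h2, ih (c - i) (by omega) hi.2 rfl, ih (i - a) (by omega) hi.1 rfl, hA, hB]
        push_cast
        ring
    have hAs : ∑ i ∈ Ioo a c, A i = ∑ i ∈ Ioo a (c + 1), A i - A c := by
      have : Ioo a (c + 1) = insert c (Ioo a c) := by ext; simp; omega
      rw [this, sum_insert (by simp)]
      ring
    have hBs : ∑ i ∈ Ioo a c, B (i + 1) = ∑ i ∈ Ioo a (c + 1), B i - B (a + 1) := by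
      have : Ioo a (c + 1) = insert (a + 1) ((Ioo a c).map (addRightEmbedding 1)) := by
        rw [map_add_right_Ioo]; ext; simp; omega
      rw [this, sum_insert (by simp), sum_map]
      simp
    have hAc : A c = (P c - P (c + 1)) * blockVol P a c := by
      simp only [hA]
      rw [div_self hne, blockVol_of_le P (le_refl (c + 1))]
      ring
    have hBa : B (a + 1) = (P (a + 1) - P a) * blockVol P (a + 1) (c + 1) := by
      simp only [hB]
      rw [blockVol_of_le P (le_refl (a + 1))]
      push_cast
      ring
    have hsum := sum_height_mul_blockVol P (show a < c + 1 by omega)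
    have hAB : ∑ i ∈ Ioo a (c + 1), A i + ∑ i ∈ Ioo a (c + 1), B i = ((c : ℝ) + 1 - a) *
        ∑ i ∈ Ioo a (c + 1), height P a (c + 1) i * blockVol P a i * blockVol P i (c + 1) := by
      have hne' : (c : ℝ) + 1 - a ≠ 0 := by
        have : (a : ℝ) < c := by exact_mod_cast hac
        intro h; linarith
      rw [← sum_add_distrib, mul_sum]
      refine sum_congr rfl fun i _ => ?_
      simp only [hA, hB, height]
      push_cast
      field_simp
      ring
    rw [hAs, hBs, hAc, hBa] at hkey
    rw [hsum] at hAB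
    push_cast at hAB
    apply mul_left_cancel₀ hne
    rw [hkey]
    linarith

/-! ### The polynomial of a Dyck path in terms of its list of steps -/

/-- The semilengths of the nonempty Dyck words that are prefixes of `L`. -/
def dyckPrefixes (L : List DyckStep) : Set ℕ :=
  {k | 1 ≤ k ∧ ∃ Q : DyckWord, Q.semilength = k ∧ Q.toList <+: L}

theorem returns_eq {n : ℕ} (D : DyckPath n) (t : ℕ) :
    returns D t = dyckPrefixes (D.1.toList.drop t) := by
  ext k
  constructor
  · rintro ⟨h1, -, Q, hQ⟩
    exact ⟨h1, Q.1, Q.2, hQ ▸ List.take_prefix _ _⟩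
  · rintro ⟨h1, Q, hQ, hpre⟩
    refine ⟨h1, ?_, ⟨Q, hQ⟩, ?_⟩
    · have e1 := hpre.sublist.count_le DyckStep.D
      have e2 := congrArg (List.count DyckStep.D) (List.take_append_drop t D.1.toList)
      rw [List.count_append] at e2
      rw [← DyckWord.semilength_eq_count_D, hQ] at e1
      rw [← DyckWord.semilength_eq_count_D, D.2] at e2
      unfold startX
      omega
    · subst hQ
      rw [Q.two_mul_semilength_eq_length]
      exact List.prefix_iff_eq_take.1 hpre

/-- The product of the polynomials of the north steps of a list of steps that starts at first
coordinate `u`. -/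
def listGamma : ℕ → List DyckStep → MvPolynomial ℕ ℝ
  | _, [] => 1
  | u, DyckStep.U :: L =>
    shift u (gamma (sSup (dyckPrefixes (DyckStep.U :: L))) (sInf (dyckPrefixes (DyckStep.U :: L)))) *
      listGamma u L
  | u, DyckStep.D :: L => listGamma (u + 1) L

theorem listGamma_eq_prod (u : ℕ) (L : List DyckStep) :
    listGamma u L = ∏ t ∈ (range L.length).filter fun t => L[t]? = some DyckStep.U,
      shift (u + (L.take t).count DyckStep.D)
        (gamma (sSup (dyckPrefixes (L.drop t))) (sInf (dyckPrefixes (L.drop t)))) := by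
  induction L generalizing u with
  | nil => simp [listGamma]
  | cons s L ih =>
    rw [prod_filter, List.length_cons, prod_range_succ']
    cases s with
    | U =>
      rw [listGamma, ih, prod_filter, mul_comm]
      simp
    | D =>
      rw [listGamma, ih, prod_filter]
      simp [add_assoc, add_comm 1]

theorem gammaPath_eq {n : ℕ} (D : DyckPath n) : gammaPath D = listGamma 0 D.1.toList := by
  rw [listGamma_eq_prod]
  refine prod_congr rfl fun t _ => ?_
  rw [gammaStep, returns_eq, startX, zero_add]

theorem shift_shift (u v : ℕ) (p : MvPolynomial ℕ ℝ) : shift u (shift v p) = shift (u + v) p := by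
  simp only [shift, MvPolynomial.rename_rename]
  congr 2
  ext j
  simp only [Function.comp]
  omega

theorem listGamma_add (u v : ℕ) (L : List DyckStep) :
    listGamma (u + v) L = shift u (listGamma v L) := by
  induction L generalizing v with
  | nil => simp [listGamma, shift]
  | cons s L ih =>
    cases s with
    | U =>
      rw [listGamma, listGamma, ih, ← shift_shift]
      simp [shift]
    | D => rw [listGamma, listGamma, add_assoc, ih]

/-- A Dyck prefix reaching beyond `L` would contain `L` followed by an east step, where the east
steps already outnumber the north steps. -/
theorem dyckPrefixes_append_D {L : List DyckStep}
    (h : L.count DyckStep.U ≤ L.count DyckStep.D) (L' : List DyckStep) :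
    dyckPrefixes (L ++ DyckStep.D :: L') = dyckPrefixes L := by
  ext k
  refine and_congr_right fun _ => exists_congr fun Q => and_congr_right fun _ => ⟨fun hQ => ?_,
    fun hQ => hQ.trans (List.prefix_append _ _)⟩
  have hL : L ++ [DyckStep.D] <+: L ++ DyckStep.D :: L' := ⟨L', by simp⟩
  rcases List.prefix_or_prefix_of_prefix hQ hL with h1 | h1
  · rcases List.prefix_concat_iff.1 h1 with h2 | h2
    · have := Q.count_U_eq_count_D
      rw [h2] at this
      simp at this
      omega
    · exact h2
  · have := Q.count_D_le_count_U (L ++ [DyckStep.D]).length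
    rw [← List.prefix_iff_eq_take.1 h1] at this
    simp at this
    omega

theorem listGamma_append_D {L : List DyckStep}
    (h : ∀ L₁, L₁ <:+ L → L₁.count DyckStep.U ≤ L₁.count DyckStep.D) (u : ℕ)
    (L' : List DyckStep) :
    listGamma u (L ++ DyckStep.D :: L') =
      listGamma u L * listGamma (u + L.count DyckStep.D + 1) L' := by
  induction L generalizing u with
  | nil => simp [listGamma]
  | cons s L ih =>
    have ih' := ih fun L₁ hL => h L₁ (hL.trans (List.suffix_cons s L))
    cases s with
    | U =>
      have := dyckPrefixes_append_D (h _ List.suffix_rfl) L'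
      rw [List.cons_append] at this
      rw [List.cons_append, listGamma, listGamma, ih', this, mul_assoc]
      simp
    | D =>
      rw [List.cons_append, listGamma, listGamma, ih', List.count_cons_self]
      congr 2
      omega

theorem count_U_le_count_D_of_suffix (A : DyckWord) {L : List DyckStep} (h : L <:+ A.toList) :
    L.count DyckStep.U ≤ L.count DyckStep.D := by
  obtain ⟨L', hL'⟩ := h
  have h1 := A.count_D_le_count_U L'.length
  have h2 := A.count_U_eq_count_D
  rw [← hL', List.take_left'  rfl] at h1
  rw [← hL', List.count_append, List.count_append] at h2
  omega

theorem sSup_dyckPrefixes (A : DyckWord) (hA : A ≠ 0) :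
    sSup (dyckPrefixes A.toList) = A.semilength := by
  have hA' : 1 ≤ A.semilength := by
    have h1 := A.two_mul_semilength_eq_length
    have h2 := List.length_pos_of_ne_nil (DyckWord.toList_ne_nil.2 hA)
    omega
  refine IsGreatest.csSup_eq ⟨⟨hA', A, rfl, List.prefix_rfl⟩, ?_⟩
  rintro k ⟨-, Q, rfl, hQ⟩
  exact hQ.sublist.count_le _

/-- The first return is the end of `A.nest`: every shorter nonempty prefix of a nested word has
strictly more north than east steps. -/
theorem sInf_dyckPrefixes (A B : DyckWord) :
    sInf (dyckPrefixes (A.nest + B).toList) = A.semilength + 1 := by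
  refine IsLeast.csInf_eq ⟨⟨by omega, A.nest, A.semilength_nest, List.prefix_append _ _⟩, ?_⟩
  rintro k ⟨h1, Q, rfl, hQ⟩
  have hcat : (A.nest + B).toList = A.nest.toList ++ B.toList := rfl
  rcases List.prefix_or_prefix_of_prefix hQ (hcat ▸ List.prefix_append _ _ :
    A.nest.toList <+: (A.nest + B).toList) with h | h
  · have hlen := Q.two_mul_semilength_eq_length
    have hlen' := A.nest.two_mul_semilength_eq_length
    rw [DyckWord.semilength_nest] at hlen'
    by_contra hlt
    have := (DyckWord.IsNested.nest (p := A)).2 (i := Q.toList.length) (by omega) (by omega)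
    rw [← List.prefix_iff_eq_take.1 h, Q.count_U_eq_count_D] at this
    exact lt_irrefl _ this
  · rw [← DyckWord.semilength_nest]
    exact h.sublist.count_le _

theorem listGamma_nest_add (A B : DyckWord) :
    listGamma 0 (A.nest + B).toList =
      gamma (A.semilength + B.semilength + 1) (A.semilength + 1) * listGamma 0 A.toList *
        shift (A.semilength + 1) (listGamma 0 B.toList) := by
  have hcat : (A.nest + B).toList =
      DyckStep.U :: (A.toList ++ DyckStep.D :: B.toList) := by
    change ([DyckStep.U] ++ A.toList ++ [DyckStep.D]) ++ B.toList = _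
    simp
  have hne : A.nest + B ≠ 0 := by
    rw [← DyckWord.toList_ne_nil, hcat]
    simp
  have hs := sSup_dyckPrefixes _ hne
  have hi := sInf_dyckPrefixes A B
  rw [hcat] at hs hi
  rw [hcat, listGamma, hs, hi,
    listGamma_append_D (fun _ => count_U_le_count_D_of_suffix A), ← mul_assoc,
    ← DyckWord.semilength_eq_count_D, ← listGamma_add, DyckWord.semilength_add,
    DyckWord.semilength_nest, add_right_comm A.semilength, zero_add, add_zero]
  congr 2
  exact MvPolynomial.rename_id_apply _

/-- The sum of the polynomials of all `n`-Dyck paths. -/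
def dyckSum (n : ℕ) : MvPolynomial ℕ ℝ := ∑ D : DyckPath n, gammaPath D

theorem dyckSum_zero : dyckSum 0 = 1 := by
  have h : ∀ D : DyckPath 0, D.1.toList = [] := by
    intro D
    have := D.1.two_mul_semilength_eq_length
    rw [D.2] at this
    exact List.length_eq_zero_iff.1 this.symm
  have hu : (univ : Finset (DyckPath 0)) = {⟨0, rfl⟩} := by
    ext D
    simp only [mem_univ, mem_singleton, true_iff]
    exact Subtype.ext (DyckWord.toList_eq_nil.1 (h D))
  rw [dyckSum, hu, sum_singleton, gammaPath_eq, h, listGamma]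

theorem dyckSum_succ (n : ℕ) :
    dyckSum (n + 1) = ∑ p ∈ antidiagonal n,
      gamma (n + 1) (p.1 + 1) * dyckSum p.1 * shift (p.1 + 1) (dyckSum p.2) := by
  have hR : ∀ p ∈ antidiagonal n,
      gamma (n + 1) (p.1 + 1) * dyckSum p.1 * shift (p.1 + 1) (dyckSum p.2) =
      ∑ q : DyckPath p.1 × DyckPath p.2, listGamma 0 (q.1.1.nest + q.2.1).toList := by
    intro p hp
    rw [HasAntidiagonal.mem_antidiagonal] at hp
    rw [Fintype.sum_prod_type, dyckSum, dyckSum, shift, map_sum,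
      mul_sum univ (gammaPath (n := p.1)), sum_mul_sum]
    refine sum_congr rfl fun A _ => sum_congr rfl fun B _ => ?_
    rw [listGamma_nest_add, A.2, B.2, hp, gammaPath_eq, gammaPath_eq, shift]
  rw [sum_congr rfl hR, sum_sigma', dyckSum]
  symm
  refine sum_bij (fun s hs => ⟨s.2.1.1.nest + s.2.2.1, ?_⟩) (fun _ _ => mem_univ _) ?_ ?_ ?_
  · rw [mem_sigma, HasAntidiagonal.mem_antidiagonal] at hs
    rw [DyckWord.semilength_add, DyckWord.semilength_nest, s.2.1.2, s.2.2.2]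
    omega
  · rintro ⟨⟨i, j⟩, ⟨A, hA⟩, ⟨B, hB⟩⟩ _ ⟨⟨i', j'⟩, ⟨A', hA'⟩, ⟨B', hB'⟩⟩ _ h
    have h' : A.nest + B = A'.nest + B' := congrArg Subtype.val h
    have e1 := congrArg DyckWord.insidePart h'
    have e2 := congrArg DyckWord.outsidePart h'
    simp only [DyckWord.insidePart_add DyckWord.nest_ne_zero, DyckWord.insidePart_nest,
      DyckWord.outsidePart_add DyckWord.nest_ne_zero, DyckWord.outsidePart_nest, zero_add] at e1 e2
    subst e1 e2
    obtain rfl : i = i' := hA.symm.trans hA'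
    obtain rfl : j = j' := hB.symm.trans hB'
    rfl
  · rintro ⟨D, hD⟩ _
    have hne : D ≠ 0 := by rintro rfl; simp at hD
    have := DyckWord.semilength_insidePart_add_semilength_outsidePart_add_one hne
    exact ⟨⟨(D.insidePart.semilength, D.outsidePart.semilength),
      ⟨D.insidePart, rfl⟩, ⟨D.outsidePart, rfl⟩⟩, by simp; omega,
      Subtype.ext (DyckWord.nest_insidePart_add_outsidePart hne)⟩
  · intro s _
    rw [gammaPath_eq]

/-! ### The evaluation of the sum over all Dyck paths -/

theorem sum_min_mul_secondDiff (P : ℕ → ℝ) {i d : ℕ} (h : i ≤ d) :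
    ∑ j ∈ range d, ((min i (j + 1) : ℕ) : ℝ) * (2 * P (j + 1) - P j - P (j + 2)) =
      i * (P d - P (d + 1)) + P i - P 0 := by
  induction d, h using Nat.le_induction with
  | base =>
    rw [sum_congr rfl fun j hj => by rw [Nat.min_eq_right (by rw [mem_range] at hj; omega)]]
    induction i with
    | zero => simp
    | succ i ih => rw [sum_range_succ, ih]; push_cast; ring
  | succ d hd ih =>
    rw [sum_range_succ, ih, Nat.min_eq_left (by omega)]
    ring

/-- `cartanInv d` is the Green's function of the discrete Laplacian with zero boundary values, so it
recovers `P` minus its chord from the negated second differences. -/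
theorem sum_cartanInv_mul_secondDiff (P : ℕ → ℝ) {i d : ℕ} (h : i ≤ d) :
    ∑ j ∈ range d, cartanInv d i (j + 1) * (2 * P (j + 1) - P j - P (j + 2)) =
      P i - P 0 - (i : ℝ) / ((d : ℝ) + 1) * (P (d + 1) - P 0) := by
  have h1 := sum_min_mul_secondDiff P h
  have h2 := sum_min_mul_secondDiff P (le_refl d)
  rw [sum_congr rfl fun j hj => by
    rw [Nat.min_eq_right (show j + 1 ≤ d by rw [mem_range] at hj; omega)]] at h2
  have h3 : ∀ j ∈ range d, cartanInv d i (j + 1) * (2 * P (j + 1) - P j - P (j + 2)) =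
      ((min i (j + 1) : ℕ) : ℝ) * (2 * P (j + 1) - P j - P (j + 2)) -
      (i : ℝ) / ((d : ℝ) + 1) *
        (((j + 1 : ℕ) : ℝ) * (2 * P (j + 1) - P j - P (j + 2))) := by
    intro j _
    simp only [cartanInv]
    push_cast
    ring
  rw [sum_congr rfl h3, sum_sub_distrib, ← mul_sum, h1, h2]
  have hd : (d : ℝ) + 1 ≠ 0 := by positivity
  field_simp
  ring

theorem eval_shift (x : ℕ → ℝ) (u : ℕ) (p : MvPolynomial ℕ ℝ) :
    MvPolynomial.eval x (shift u p) = MvPolynomial.eval (fun j => x (j + u)) p := by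
  rw [shift, MvPolynomial.eval_rename]
  rfl

theorem eval_gamma {x P : ℕ → ℝ} {a d i : ℕ} (hi : i ≤ d)
    (hx : ∀ j < d, x j = 2 * P (a + j + 1) - P (a + j) - P (a + j + 2)) :
    MvPolynomial.eval x (gamma d i) =
      1 / (d * √(cartanInv d i i)) * ((d + 1).choose i : ℝ) *
        height P a (a + d + 1) (a + i) := by
  have h := sum_cartanInv_mul_secondDiff (fun j => P (a + j)) hi
  simp only [gamma, map_mul, map_sum, MvPolynomial.eval_C, MvPolynomial.eval_X]
  congr 1
  rw [height]
  push_cast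
  rw [add_sub_cancel_left, add_assoc (a : ℝ), add_sub_cancel_left]
  refine Eq.trans (sum_congr rfl fun j hj => ?_) h
  rw [hx j (mem_range.1 hj)]
  rfl

/-- With `c_{d,i,i} = i k / (d + 1)`, the square root and the binomial coefficient are exactly what
converts the normalising factors of the two blocks into that of the whole. -/
theorem gamma_coeff {d i k : ℕ} (hi : 0 < i) (hk : 0 < k) (h : i + k = d + 1) :
    1 / (d * √(cartanInv d i i)) * ((d + 1).choose i : ℝ) *
      (√i * (i.factorial : ℝ)) * (√k * (k.factorial : ℝ)) =
      √((d : ℝ) + 1) * ((d + 1).factorial : ℝ) * (d : ℝ)⁻¹ := by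
  have hch := Nat.choose_mul_factorial_mul_factorial (show i ≤ d + 1 by omega)
  rw [show d + 1 - i = k by omega] at hch
  have hi' : (0 : ℝ) < i := by exact_mod_cast hi
  have hk' : (0 : ℝ) < k := by exact_mod_cast hk
  have hd : (d : ℝ) + 1 = i + k := by exact_mod_cast h.symm
  have hc : cartanInv d i i = (i * k : ℝ) / (d + 1) := by
    rw [cartanInv, min_self, hd]
    field_simp
    ring
  have hdp : (0 : ℝ) < (d : ℝ) + 1 := by positivity
  have h1 : √(i : ℝ) ≠ 0 := (Real.sqrt_pos.2 hi').ne'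
  have h2 : √(k : ℝ) ≠ 0 := (Real.sqrt_pos.2 hk').ne'
  have h3 : √((d : ℝ) + 1) ≠ 0 := (Real.sqrt_pos.2 hdp).ne'
  rw [hc, Real.sqrt_div (by positivity), Real.sqrt_mul hi'.le, ← hch]
  push_cast
  rcases eq_or_ne (d : ℝ) 0 with h0 | h0
  · simp [h0]
  · field_simp

/-- The offset `a` absorbs the shift of variables in the second factor of the recursion, so that
both factors are blocks of one sequence `P`. -/
theorem eval_dyckSum {x P : ℕ → ℝ} {a m : ℕ}
    (hx : ∀ j < m, x j = 2 * P (a + j + 1) - P (a + j) - P (a + j + 2)) :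
    MvPolynomial.eval x (dyckSum m) =
      √((m : ℝ) + 1) * ((m + 1).factorial : ℝ) * blockVol P a (a + m + 1) := by
  induction m using Nat.strong_induction_on generalizing a x with
  | _ m ih =>
    cases m with
    | zero => simp [dyckSum_zero, blockVol_of_le]
    | succ n =>
      rw [dyckSum_succ, map_sum, blockVol_eq P (by omega),
        show Ioo a (a + (n + 1) + 1) = Ico (a + 1) (a + (n + 1) + 1) from rfl,
        sum_Ico_eq_sum_range, Nat.sum_antidiagonal_eq_sum_range_succ_mk,
        show a + (n + 1) + 1 - (a + 1) = n.succ by omega, mul_sum, mul_sum]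
      refine sum_congr rfl fun i hi => ?_
      rw [mem_range] at hi
      rw [map_mul, map_mul, eval_shift, eval_gamma (by omega) hx,
        ih i (by omega) fun j hj => hx j (by omega),
        ih (n - i) (by omega) (a := a + 1 + i) fun j hj => by
          rw [hx _ (by omega), show a + (j + (i + 1)) = a + 1 + i + j by omega]]
      have hco := gamma_coeff (d := n + 1) (i := i + 1) (k := n - i + 1) (by omega) (by omega)
        (by omega)
      rw [show a + (i + 1) = a + 1 + i by ring, show a + i + 1 = a + 1 + i by ring,
        show a + 1 + i + (n - i) + 1 = a + (n + 1) + 1 by omega]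
      have e : ((a + (n + 1) + 1 : ℕ) : ℝ) - a - 1 = ((n + 1 : ℕ) : ℝ) := by push_cast; ring
      rw [e]
      rw [Nat.cast_add_one i, Nat.cast_add_one (n - i)] at hco
      linear_combination (height P a (a + (n + 1) + 1) (a + 1 + i) * blockVol P a (a + 1 + i) *
        blockVol P (a + 1 + i) (a + (n + 1) + 1)) * hco

/-! ### Rado's description of the permutohedron -/

/-- The polytope of the vectors majorized by the sequence with partial sums `P`. -/
def majPolytope (n : ℕ) (P : ℕ → ℝ) : Set (Fin (n + 1) → ℝ) :=
  {y | ∑ i, y i = P (n + 1) ∧ ∀ S : Finset (Fin (n + 1)), ∑ i ∈ S, y i ≤ P S.card}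

/-- The rearrangements of the sequence with partial sums `P`. -/
def rearrangements (n : ℕ) (P : ℕ → ℝ) : Set (Fin (n + 1) → ℝ) :=
  {y | ∃ σ : Equiv.Perm (Fin (n + 1)), ∀ i, y i = P (σ i + 1) - P (σ i)}

/-- The sequence with partial sums `P` is antitone. -/
def IsConcave (P : ℕ → ℝ) : Prop := ∀ k, P (k + 2) - P (k + 1) ≤ P (k + 1) - P k

theorem IsConcave.diff_le {P : ℕ → ℝ} (hP : IsConcave P) {i j : ℕ} (h : i ≤ j) :
    P (j + 1) - P j ≤ P (i + 1) - P i :=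
  antitone_nat_of_succ_le (f := fun k => P (k + 1) - P k) hP h

theorem IsConcave.slice {P : ℕ → ℝ} (hP : IsConcave P) {k : ℕ} {t : ℝ}
    (h1 : P (k + 2) - P (k + 1) ≤ t) (h2 : t ≤ P (k + 1) - P k) :
    IsConcave (slice (k + 1) t P) := by
  intro j
  simp only [Permutohedron.slice]
  rcases lt_trichotomy (j + 1) k with h | h | h
  · rw [if_pos (by omega), if_pos (by omega), if_pos (by omega)]
    exact hP j
  · subst h
    rw [if_neg (by omega), if_pos (by omega), if_pos (by omega)]
    have := hP j
    linarith
  · rcases Nat.lt_or_ge k (j) with h' | h'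
    · rw [if_neg (by omega), if_neg (by omega), if_neg (by omega)]
      have := hP (j + 1)
      linarith
    · obtain rfl : k = j := by omega
      rw [if_neg (by omega), if_neg (by omega), if_pos (by omega)]
      have := hP (k + 1)
      linarith

theorem exists_eq_map_succ_or_cons {n : ℕ} (S : Finset (Fin (n + 1))) :
    ∃ T : Finset (Fin n), S = T.map (Fin.succEmb n) ∨ S = insert 0 (T.map (Fin.succEmb n)) := by
  refine ⟨univ.filter fun i => i.succ ∈ S, ?_⟩
  by_cases h : 0 ∈ S
  · right
    ext i
    cases i using Fin.cases <;> simp [h, Fin.succ_ne_zero]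
  · left
    ext i
    cases i using Fin.cases <;> simp [h, Fin.succ_ne_zero]

/-- A set `T` of remaining coordinates is bounded both by `P T.card` and, after adding the first
coordinate, by `P (T.card + 1) - t`. Concavity and the position of `t` decide which bound is
smaller, and the slice records the smaller one. -/
theorem cons_mem_majPolytope_iff {n k : ℕ} {P : ℕ → ℝ} (hP : IsConcave P) (hk : k ≤ n) {t : ℝ}
    (h1 : P (k + 2) - P (k + 1) ≤ t) (h2 : t ≤ P (k + 1) - P k) (y : Fin (n + 1) → ℝ) :
    (Fin.cons t y : Fin (n + 2) → ℝ) ∈ majPolytope (n + 1) P ↔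
      y ∈ majPolytope n (slice (k + 1) t P) := by
  have hmap : ∀ T : Finset (Fin (n + 1)),
      ∑ i ∈ T.map (Fin.succEmb (n + 1)), (Fin.cons t y : Fin (n + 2) → ℝ) i = ∑ i ∈ T, y i := by
    intro T; simp
  have hcons : ∀ T : Finset (Fin (n + 1)),
      ∑ i ∈ insert 0 (T.map (Fin.succEmb (n + 1))), (Fin.cons t y : Fin (n + 2) → ℝ) i =
        t + ∑ i ∈ T, y i := by
    intro T
    rw [sum_insert (by simp [Fin.succ_ne_zero]), hmap, Fin.cons_zero]
  have hcard : ∀ T : Finset (Fin (n + 1)),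
      (insert 0 (T.map (Fin.succEmb (n + 1)))).card = T.card + 1 := by
    intro T
    rw [card_insert_of_notMem (by simp [Fin.succ_ne_zero]), card_map]
  have htot : slice (k + 1) t P (n + 1) = P (n + 2) - t := if_neg (by omega)
  simp only [majPolytope, Set.mem_ofPred_eq, htot]
  rw [Fin.sum_univ_succ]
  simp only [Fin.cons_zero, Fin.cons_succ]
  refine and_congr ⟨fun h => by linarith, fun h => by linarith⟩ ⟨fun h T => ?_, fun h S => ?_⟩
  · simp only [slice]
    split_ifs
    · have := h (T.map (Fin.succEmb (n + 1)))
      rwa [hmap, card_map] at this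
    · have := h (insert 0 (T.map (Fin.succEmb (n + 1))))
      rw [hcons, hcard] at this
      linarith
  · obtain ⟨T, rfl | rfl⟩ := exists_eq_map_succ_or_cons S
    · rw [hmap, card_map]
      refine (h T).trans ?_
      simp only [slice]
      split_ifs with hT
      · exact le_rfl
      · have := hP.diff_le (show k + 1 ≤ T.card by omega)
        linarith
    · rw [hcons, hcard]
      have := h T
      simp only [slice] at this
      split_ifs at this with hT
      · have := hP.diff_le (show T.card ≤ k by omega)
        linarith
      · linarith

theorem exists_between_consecutive {f : ℕ → ℝ} {n : ℕ} {t : ℝ} (h0 : t ≤ f 0)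
    (hn : f (n + 1) ≤ t) : ∃ k ≤ n, f (k + 1) ≤ t ∧ t ≤ f k := by
  induction n with
  | zero => exact ⟨0, le_rfl, hn, h0⟩
  | succ n ih =>
    rcases le_total (f (n + 1)) t with h | h
    · obtain ⟨k, hk, h'⟩ := ih h
      exact ⟨k, by omega, h'⟩
    · exact ⟨n + 1, le_rfl, hn, h⟩

theorem le_of_mem_majPolytope {n : ℕ} {P : ℕ → ℝ} {y : Fin (n + 1) → ℝ}
    (h : y ∈ majPolytope n P) (i : Fin (n + 1)) : y i ≤ P 1 := by
  simpa using h.2 {i}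

theorem ge_of_mem_majPolytope {n : ℕ} {P : ℕ → ℝ} {y : Fin (n + 1) → ℝ}
    (h : y ∈ majPolytope n P) (i : Fin (n + 1)) : P (n + 1) - P n ≤ y i := by
  have h1 := h.2 {i}ᶜ
  rw [card_compl, card_singleton, Fintype.card_fin, Nat.add_sub_cancel] at h1
  have h2 := sum_compl_add_sum {i} y
  rw [sum_singleton, h.1] at h2
  linarith

theorem cons_mem_rearrangements {n : ℕ} (P : ℕ → ℝ) (p : Fin (n + 2))
    (σ : Equiv.Perm (Fin (n + 1))) :
    (Fin.cons (P (p + 1) - P p) fun i => P (p.succAbove (σ i) + 1) - P (p.succAbove (σ i)) :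
      Fin (n + 2) → ℝ) ∈ rearrangements (n + 1) P := by
  have hinj : Function.Injective (Fin.cons p fun i => p.succAbove (σ i) : Fin (n + 2) → _) := by
    rw [Fin.cons_injective_iff]
    exact ⟨by rintro ⟨i, hi⟩; exact Fin.succAbove_ne _ _ hi,
      Fin.succAbove_right_injective.comp σ.injective⟩
  refine ⟨Equiv.ofBijective _ (Finite.injective_iff_bijective.1 hinj), fun i => ?_⟩
  cases i using Fin.cases <;> simp

/-- By induction, it suffices to treat a vertex of the slice at `t`. It lies on the segment joining
two rearrangements that differ by exchanging consecutive terms. -/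
theorem majPolytope_subset_convexHull {n : ℕ} {P : ℕ → ℝ} (hP : IsConcave P) (h0 : P 0 = 0) :
    majPolytope n P ⊆ convexHull ℝ (rearrangements n P) := by
  induction n generalizing P with
  | zero =>
    intro y hy
    refine subset_convexHull ℝ _ ⟨1, fun i => ?_⟩
    have := hy.1
    obtain rfl := Fin.fin_one_eq_zero i
    simpa [h0] using this
  | succ n ih =>
    intro y hy
    obtain ⟨k, hk, h1, h2⟩ := exists_between_consecutive (f := fun k => P (k + 1) - P k)
      (by simpa [h0] using le_of_mem_majPolytope hy 0) (ge_of_mem_majPolytope hy 0)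
    obtain ⟨t, y, rfl⟩ : ∃ t z, y = Fin.cons t z := ⟨y 0, Fin.tail y, (Fin.cons_self_tail y).symm⟩
    rw [Fin.cons_zero] at h1 h2
    rw [cons_mem_majPolytope_iff hP hk h1 h2] at hy
    have hconv : Convex ℝ {z : Fin (n + 1) → ℝ |
        (Fin.cons t z : Fin (n + 2) → ℝ) ∈ convexHull ℝ (rearrangements (n + 1) P)} := by
      intro z hz w hw a b ha hb hab
      have := convex_convexHull ℝ (rearrangements (n + 1) P) hz hw ha hb hab
      rw [Set.mem_ofPred_eq]
      convert this using 1
      ext i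
      cases i using Fin.cases
      · simp [← add_mul, hab]
      · simp
    refine convexHull_min ?_ hconv (ih (hP.slice h1 h2) (by simp [slice, h0]) hy)
    rintro z ⟨σ, hz⟩
    have hseg : t ∈ segment ℝ (P (k + 2) - P (k + 1)) (P (k + 1) - P k) := by
      rw [segment_eq_Icc (hP k)]
      exact ⟨h1, h2⟩
    -- The merged entry, the sum of the two terms minus `t`, is the combination of the same two
    -- terms with the weights exchanged; hence the same `a` and `b` work in every coordinate.
    obtain ⟨a, b, ha, hb, hab, rfl⟩ := hseg
    have hp := cons_mem_rearrangements P (⟨k, by omega⟩ : Fin (n + 2)) σ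
    have hq := cons_mem_rearrangements P (⟨k + 1, by omega⟩ : Fin (n + 2)) σ
    have := convex_convexHull ℝ (rearrangements (n + 1) P) (subset_convexHull ℝ _ hq)
      (subset_convexHull ℝ _ hp) ha hb hab
    rw [Set.mem_ofPred_eq]
    convert this using 1
    ext i
    cases i using Fin.cases with
    | zero => simp
    | succ i =>
      simp only [Fin.cons_succ, hz, Pi.add_apply, Pi.smul_apply, smul_eq_mul, Fin.succAbove,
        Fin.lt_def, Fin.val_castSucc, slice]
      obtain rfl : b = 1 - a := by linarith
      rcases lt_trichotomy (σ i : ℕ) k with h | h | h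
      · rw [if_pos (by omega), if_pos (by omega), if_pos (by omega), if_pos (by omega)]
        simp only [Fin.val_castSucc]
        ring
      · rw [if_neg (by omega), if_pos (by omega), if_pos (by omega), if_neg (by omega)]
        simp only [Fin.val_castSucc, Fin.val_succ, h]
        ring
      · rw [if_neg (by omega), if_neg (by omega), if_neg (by omega), if_neg (by omega)]
        simp only [Fin.val_succ]
        ring

theorem convex_majPolytope (n : ℕ) (P : ℕ → ℝ) : Convex ℝ (majPolytope n P) := by
  intro y hy z hz a b ha hb hab
  have h : ∀ S : Finset (Fin (n + 1)),
      ∑ i ∈ S, (a • y + b • z) i = a * ∑ i ∈ S, y i + b * ∑ i ∈ S, z i := by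
    intro S
    simp [sum_add_distrib, mul_sum]
  refine ⟨?_, fun S => ?_⟩
  · rw [h, hy.1, hz.1, ← add_mul, hab, one_mul]
  · rw [h]
    calc a * ∑ i ∈ S, y i + b * ∑ i ∈ S, z i ≤ a * P S.card + b * P S.card := by
          gcongr
          exacts [hy.2 S, hz.2 S]
      _ = P S.card := by rw [← add_mul, hab, one_mul]

theorem IsConcave.sum_diff_le {P : ℕ → ℝ} (hP : IsConcave P) (S : Finset ℕ) :
    ∑ j ∈ S, (P (j + 1) - P j) ≤ P S.card - P 0 := by
  induction S using Finset.induction_on_max with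
  | empty => simp
  | insert a S hlt ih =>
    have ha : a ∉ S := fun h => lt_irrefl _ (hlt a h)
    have hcard : S.card ≤ a := by
      simpa using card_le_card fun j hj => mem_range.2 (hlt j hj)
    rw [sum_insert ha, card_insert_of_notMem ha]
    have := hP.diff_le hcard
    linarith

theorem convexHull_rearrangements {n : ℕ} {P : ℕ → ℝ} (hP : IsConcave P) (h0 : P 0 = 0) :
    convexHull ℝ (rearrangements n P) = majPolytope n P := by
  refine Set.Subset.antisymm (convexHull_min ?_ (convex_majPolytope n P))
    (majPolytope_subset_convexHull hP h0)
  rintro y ⟨σ, hy⟩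
  refine ⟨?_, fun S => ?_⟩
  · simp only [hy]
    rw [Equiv.sum_comp σ fun i : Fin (n + 1) => P (i + 1) - P i,
      Fin.sum_univ_eq_sum_range (fun i => P (i + 1) - P i), sum_range_sub, h0, sub_zero]
  · have h := hP.sum_diff_le (S.map (σ.toEmbedding.trans Fin.valEmbedding))
    rw [sum_map, card_map, h0, sub_zero] at h
    simp only [hy]
    exact h

/-! ### The volume of the projected permutohedron -/

/-- The projection of the polytope of the vectors majorized by the sequence with partial sums `P`
along the last coordinate. -/
def projPolytope (n : ℕ) (P : ℕ → ℝ) : Set (Fin n → ℝ) :=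
  {y | (Fin.snoc y (P (n + 1) - ∑ i, y i) : Fin (n + 1) → ℝ) ∈ majPolytope n P}

theorem isClosed_projPolytope (n : ℕ) (P : ℕ → ℝ) : IsClosed (projPolytope n P) := by
  have hM : IsClosed (majPolytope n P) := by
    have : majPolytope n P = {y | ∑ i, y i = P (n + 1)} ∩
        ⋂ S : Finset (Fin (n + 1)), {y | ∑ i ∈ S, y i ≤ P S.card} := by
      ext; simp [majPolytope]
    rw [this]
    exact (isClosed_eq (by fun_prop) (by fun_prop)).inter
      (isClosed_iInter fun S => isClosed_le (by fun_prop) (by fun_prop))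
  exact hM.preimage (Continuous.finSnoc (A := fun _ => ℝ) continuous_id (by fun_prop))

theorem cons_mem_projPolytope_iff {n k : ℕ} {P : ℕ → ℝ} (hP : IsConcave P) (hk : k ≤ n) {t : ℝ}
    (h1 : P (k + 2) - P (k + 1) ≤ t) (h2 : t ≤ P (k + 1) - P k) (y : Fin n → ℝ) :
    (Fin.cons t y : Fin (n + 1) → ℝ) ∈ projPolytope (n + 1) P ↔
      y ∈ projPolytope n (slice (k + 1) t P) := by
  have htot : slice (k + 1) t P (n + 1) = P (n + 2) - t := if_neg (by omega)
  rw [projPolytope, Set.mem_ofPred_eq, ← Fin.cons_snoc_eq_snoc_cons,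
    cons_mem_majPolytope_iff hP hk h1 h2, Fin.sum_univ_succ, projPolytope, Set.mem_ofPred_eq, htot]
  simp only [Fin.cons_zero, Fin.cons_succ, sub_sub]

theorem mem_Icc_of_cons_mem_projPolytope {n : ℕ} {P : ℕ → ℝ} (h0 : P 0 = 0) {t : ℝ}
    {y : Fin n → ℝ} (h : (Fin.cons t y : Fin (n + 1) → ℝ) ∈ projPolytope (n + 1) P) :
    t ∈ Set.Icc (P (n + 2) - P (n + 1)) (P 1 - P 0) := by
  rw [projPolytope, Set.mem_ofPred_eq, ← Fin.cons_snoc_eq_snoc_cons] at h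
  have h1 := ge_of_mem_majPolytope h 0
  have h2 := le_of_mem_majPolytope h 0
  rw [Fin.cons_zero] at h1 h2
  exact ⟨h1, by rwa [h0, sub_zero]⟩

theorem volume_eq_lintegral_cons {n : ℕ} {S : Set (Fin (n + 1) → ℝ)} (hS : MeasurableSet S) :
    volume S = ∫⁻ t, volume {y : Fin n → ℝ | (Fin.cons t y : Fin (n + 1) → ℝ) ∈ S} := by
  have h := (volume_preserving_piFinSuccAbove (fun _ : Fin (n + 1) => ℝ) 0).symm
  rw [← h.measure_preimage hS.nullMeasurableSet, Measure.volume_eq_prod,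
    Measure.prod_apply (h.measurable hS)]
  congr 1
  ext t
  congr 1
  ext y
  simp [MeasurableEquiv.piFinSuccAbove_symm_apply, Fin.insertNthEquiv]

theorem setLIntegral_Ioc_eq_sum {l : ℕ → ℝ} (hl : Antitone l) (f : ℝ → ENNReal) (m : ℕ) :
    ∫⁻ t in Set.Ioc (l m) (l 0), f t =
      ∑ k ∈ range m, ∫⁻ t in Set.Ioc (l (k + 1)) (l k), f t := by
  induction m with
  | zero => simp
  | succ m ih =>
    rw [sum_range_succ, ← ih, add_comm (∫⁻ t in Set.Ioc (l m) (l 0), f t),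
      ← Set.Ioc_union_Ioc_eq_Ioc (hl (Nat.le_succ m)) (hl (Nat.zero_le m)),
      lintegral_union measurableSet_Ioc (Set.Ioc_disjoint_Ioc_of_le le_rfl)]

/-- Nonnegativity is carried through the induction because `ENNReal.ofReal` is additive only on
nonnegative summands. -/
theorem volume_projPolytope {n : ℕ} {P : ℕ → ℝ} (hP : IsConcave P) (h0 : P 0 = 0) :
    0 ≤ blockVol P 0 (n + 1) ∧
      volume (projPolytope n P) = ENNReal.ofReal ((n + 1).factorial * blockVol P 0 (n + 1)) := by
  induction n generalizing P with
  | zero =>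
    have : projPolytope 0 P = Set.univ := by
      ext y
      simp only [projPolytope, majPolytope, Set.mem_ofPred_eq, Set.mem_univ, iff_true]
      have hy : (Fin.snoc y (P (0 + 1) - ∑ i, y i) : Fin (0 + 1) → ℝ) = fun _ => P 1 := by
        ext i
        obtain rfl := Fin.fin_one_eq_zero i
        change (Fin.snoc y (P (0 + 1) - ∑ i, y i) : Fin (0 + 1) → ℝ) (Fin.last 0) = P 1
        rw [Fin.snoc_last]
        simp
      rw [hy]
      refine ⟨by simp, fun S => ?_⟩
      rcases Finset.eq_empty_or_nonempty S with rfl | h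
      · simp [h0]
      · have : S.card = 1 := le_antisymm (card_le_univ S) h.card_pos
        simp [this]
    rw [this, blockVol_of_le P le_rfl]
    simp [volume_pi]
  | succ n ih =>
    have hint : ∀ k ≤ n, 0 ≤ sliceIntegral P (k + 1) 0 (n + 1) ∧
        ∫⁻ t in Set.Ioc (P (k + 2) - P (k + 1)) (P (k + 1) - P k),
          volume {y : Fin n → ℝ | (Fin.cons t y : Fin (n + 1) → ℝ) ∈ projPolytope (n + 1) P} =
        ENNReal.ofReal ((n + 1).factorial * sliceIntegral P (k + 1) 0 (n + 1)) := by
      intro k hk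
      have hih := fun t (ht : t ∈ Set.Ioc (P (k + 2) - P (k + 1)) (P (k + 1) - P k)) =>
        ih (hP.slice ht.1.le ht.2) (by simp [slice, h0])
      have hcont := continuous_blockVol_slice (k + 1) P 0 (n + 1)
      have hnn : 0 ≤ᵐ[volume.restrict (Set.Ioc (P (k + 2) - P (k + 1)) (P (k + 1) - P k))]
          fun t => blockVol (slice (k + 1) t P) 0 (n + 1) :=
        (ae_restrict_iff' measurableSet_Ioc).2 (.of_forall fun t ht => (hih t ht).1)
      have hI : sliceIntegral P (k + 1) 0 (n + 1) =
          ∫ t in Set.Ioc (P (k + 2) - P (k + 1)) (P (k + 1) - P k),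
            blockVol (slice (k + 1) t P) 0 (n + 1) := by
        rw [sliceIntegral, Nat.add_sub_cancel, intervalIntegral.integral_of_le (hP k)]
      refine ⟨hI ▸ integral_nonneg_of_ae hnn, ?_⟩
      rw [hI, ← integral_const_mul, ofReal_integral_eq_lintegral_ofReal
        ((hcont.const_mul _).integrableOn_Ioc)
        (hnn.mono fun t ht => mul_nonneg (by positivity) ht)]
      refine setLIntegral_congr_fun measurableSet_Ioc fun t ht => ?_
      have hset : {y : Fin n → ℝ | (Fin.cons t y : Fin (n + 1) → ℝ) ∈ projPolytope (n + 1) P} =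
          projPolytope n (slice (k + 1) t P) :=
        Set.ext fun y => cons_mem_projPolytope_iff hP hk ht.1.le ht.2 y
      rw [hset, (hih t ht).2]
    have hsum := sum_sliceIntegral P (Nat.succ_pos n)
    rw [show Ioo 0 (n.succ + 1) = Ico 1 (n + 2) from rfl, sum_Ico_eq_sum_range,
      show n + 2 - 1 = n + 1 from rfl] at hsum
    simp only [add_comm 1] at hsum
    have hnn : ∀ k ∈ range (n + 1), 0 ≤ sliceIntegral P (k + 1) 0 (n + 1) := fun k hk =>
      (hint k (Nat.le_of_lt_succ (mem_range.1 hk))).1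
    have hpos : (0 : ℝ) < (n.succ : ℝ) + 1 - (0 : ℕ) := by
      rw [Nat.cast_zero, sub_zero]
      positivity
    have hsupp : (Function.support fun t => volume {y : Fin n → ℝ |
        (Fin.cons t y : Fin (n + 1) → ℝ) ∈ projPolytope (n + 1) P}) ⊆
        Set.Icc (P (n + 2) - P (n + 1)) (P 1 - P 0) := by
      intro t ht
      obtain ⟨y, hy⟩ := nonempty_of_measure_ne_zero (Function.mem_support.1 ht)
      exact mem_Icc_of_cons_mem_projPolytope h0 hy
    refine ⟨nonneg_of_mul_nonneg_right (hsum ▸ sum_nonneg hnn) hpos, ?_⟩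
    rw [volume_eq_lintegral_cons (isClosed_projPolytope _ _).measurableSet,
      ← setLIntegral_eq_of_support_subset hsupp, ← setLIntegral_congr Ioc_ae_eq_Icc,
      setLIntegral_Ioc_eq_sum (l := fun k => P (k + 1) - P k) (antitone_nat_of_succ_le hP) _ (n + 1),
      sum_congr rfl fun k hk => (hint k (Nat.le_of_lt_succ (mem_range.1 hk))).2,
      ← ENNReal.ofReal_sum_of_nonneg fun k hk => mul_nonneg (by positivity) (hnn k hk),
      ← mul_sum, hsum, Nat.factorial_succ (n + 1)]
    push_cast
    congr 1
    ring

/-! ### The Euclidean volume in coordinates -/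

/-- The coordinates on `E` given by all but the last coordinate. -/
def dropLast (n : ℕ) : E n ≃ₗ[ℝ] (Fin n → ℝ) where
  toFun w i := w.1 i.castSucc
  map_add' _ _ := rfl
  map_smul' _ _ := rfl
  invFun y := ⟨WithLp.toLp 2 (Fin.snoc y (-∑ i, y i) : Fin (n + 1) → ℝ), by
    change ∑ k, (Fin.snoc y (-∑ i, y i) : Fin (n + 1) → ℝ) k = 0
    simp [Fin.sum_univ_castSucc]⟩
  left_inv w := by
    have hw : ∑ k, w.1 k = 0 := w.2
    rw [Fin.sum_univ_castSucc] at hw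
    ext k
    cases k using Fin.lastCases with
    | last => simp; linarith
    | cast i => simp
  right_inv y := by
    ext i
    simp

/-- The basis vectors are `ε_i - ε_{n+1}`, so the Gram matrix is the identity plus the all-ones
matrix, a rank-one update. -/
theorem det_gram_dropLast_symm (n : ℕ) :
    (Matrix.gram ℝ fun i => (dropLast n).symm (Pi.single i 1)).det = (n : ℝ) + 1 := by
  have h : Matrix.gram ℝ (fun i => (dropLast n).symm (Pi.single i 1)) =
      (1 : Matrix (Fin n) (Fin n) ℝ) +
        Matrix.replicateCol Unit (fun _ => (1 : ℝ)) *
          Matrix.replicateRow Unit (fun _ => (1 : ℝ)) := by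
    ext i j
    simp only [Matrix.gram, Matrix.of_apply, Submodule.coe_inner, PiLp.inner_apply,
      Fin.sum_univ_castSucc]
    simp [dropLast, Matrix.one_apply, Pi.single_apply, Matrix.mul_apply, eq_comm]
  rw [h, Matrix.det_one_add_replicateCol_mul_replicateRow]
  simp [dotProduct, add_comm]

/-- By uniqueness of Haar measure only one parallelepiped has to be measured, and its volume is the
square root of its Gram determinant. -/
theorem vol_preimage_dropLast (n : ℕ) (S : Set (Fin n → ℝ)) :
    vol n (dropLast n ⁻¹' S) = ENNReal.ofReal √((n : ℝ) + 1) * volume S := by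
  let f : (Fin n → ℝ) ≃L[ℝ] E n := (dropLast n).symm.toContinuousLinearEquiv
  let b : Module.Basis (Fin n) ℝ (E n) := (Pi.basisFun ℝ (Fin n)).map f.toLinearEquiv
  have hb : ∀ i, b i = (dropLast n).symm (Pi.single i 1) := fun i => by
    simp only [b, Module.Basis.map_apply, Pi.basisFun_apply]
    rfl
  let ob : OrthonormalBasis (Fin n) ℝ (E n) := (stdOrthonormalBasis ℝ (E n)).reindex
    (finCongr (by rw [Module.finrank_eq_card_basis b, Fintype.card_fin]))
  have hvol : vol n = ob.toBasis.addHaar := by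
    rw [vol, OrthonormalBasis.addHaar_eq_volume, OrthonormalBasis.addHaar_eq_volume]
  have hpar : vol n (parallelepiped b) = ENNReal.ofReal √((n : ℝ) + 1) := by
    rw [hvol, Measure.addHaar_parallelepiped]
    congr 1
    have hgram := det_gram_dropLast_symm n
    simp only [← hb] at hgram
    rw [Matrix.gram_eq_conjTranspose_mul ob, Matrix.det_mul, Matrix.det_conjTranspose,
      star_trivial, ← sq] at hgram
    rw [← hgram, Real.sqrt_sq_eq_abs, Module.Basis.det_apply]
    rfl
  have hmap : Measure.map f volume = b.addHaar := by
    rw [← Module.Basis.map_addHaar, ← addHaarMeasure_eq_volume_pi,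
      ← Module.Basis.parallelepiped_basisFun, ← Module.Basis.addHaar]
  have hinv : (vol n).IsAddHaarMeasure := by rw [vol]; infer_instance
  have hunique : vol n = vol n (parallelepiped b) • b.addHaar := by
    rw [Module.Basis.addHaar, ← Module.Basis.coe_parallelepiped]
    exact Measure.addHaarMeasure_unique _ _
  rw [hunique, Measure.smul_apply, hpar, ← hmap,
    show (f : (Fin n → ℝ) → E n) = f.toHomeomorph from rfl,
    f.toHomeomorph.measurableEmbedding.map_apply, smul_eq_mul]
  congr 2
  ext y
  simp [f]

/-! ### The volume polynomial -/

/-- The partial sums of the coordinates of `∑ i, x i • ϖ_i`. -/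
def weightSums (n : ℕ) (x : ℕ → ℝ) (j : ℕ) : ℝ :=
  ∑ i ∈ range n, x i * cartanInv n j (i + 1)

theorem weightSums_zero (n : ℕ) (x : ℕ → ℝ) : weightSums n x 0 = 0 := by
  simp [weightSums, cartanInv]

theorem weightSums_succ_self (n : ℕ) (x : ℕ → ℝ) : weightSums n x (n + 1) = 0 := by
  refine sum_eq_zero fun i hi => ?_
  have hn : (n : ℝ) + 1 ≠ 0 := by positivity
  rw [cartanInv, Nat.min_eq_right (by rw [mem_range] at hi; omega)]
  push_cast
  field_simp
  ring

theorem secondDiff_cartanInv (n i j : ℕ) :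
    2 * cartanInv n (j + 1) (i + 1) - cartanInv n j (i + 1) - cartanInv n (j + 2) (i + 1) =
      if i = j then 1 else 0 := by
  simp only [cartanInv]
  rcases lt_trichotomy i j with h | h | h
  · rw [if_neg h.ne, Nat.min_eq_right (by omega), Nat.min_eq_right (by omega),
      Nat.min_eq_right (by omega)]
    push_cast
    ring
  · subst h
    rw [if_pos rfl, min_self, Nat.min_eq_left (by omega), Nat.min_eq_right (by omega)]
    push_cast
    ring
  · rw [if_neg h.ne', Nat.min_eq_left (by omega), Nat.min_eq_left (by omega),
      Nat.min_eq_left (by omega)]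
    push_cast
    ring

theorem secondDiff_weightSums (n : ℕ) (x : ℕ → ℝ) (j : ℕ) :
    2 * weightSums n x (j + 1) - weightSums n x j - weightSums n x (j + 2) =
      if j < n then x j else 0 := by
  simp only [weightSums, mul_sum, ← sum_sub_distrib]
  rw [sum_congr rfl fun i _ => show _ = x i * (if i = j then 1 else 0) by
    rw [← secondDiff_cartanInv n i j]; ring]
  simp

theorem isConcave_weightSums {n : ℕ} {x : ℕ → ℝ} (hx : ∀ j < n, 0 ≤ x j) :
    IsConcave (weightSums n x) := by
  intro j
  have h := secondDiff_weightSums n x j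
  split_ifs at h with hj
  · have := hx j hj
    linarith
  · linarith

theorem coe_sum_fundamentalWeight (n : ℕ) (x : ℕ → ℝ) (k : Fin (n + 1)) :
    (∑ i : Fin n, x i • fundamentalWeight n i).1 k =
      weightSums n x (k + 1) - weightSums n x k := by
  have h1 : (∑ i : Fin n, x i • fundamentalWeight n i).1 k =
      ∑ i : Fin n, x i * (fundamentalWeight n i).1 k := by
    simp
  rw [h1, weightSums, weightSums, ← sum_sub_distrib,
    ← Fin.sum_univ_eq_sum_range (fun i => x i * cartanInv n (k + 1) (i + 1) -
      x i * cartanInv n k (i + 1))]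
  refine sum_congr rfl fun i _ => ?_
  simp only [fundamentalWeight, cartanInv]
  split_ifs with h
  · rw [Nat.min_eq_left (by omega), Nat.min_eq_left (by omega)]
    push_cast
    ring
  · rw [Nat.min_eq_right (by omega), Nat.min_eq_right (by omega)]
    push_cast
    ring

/-- The coordinates of a vector of `E`. -/
def coords (n : ℕ) : E n →ₗ[ℝ] (Fin (n + 1) → ℝ) where
  toFun w := w.1
  map_add' _ _ := rfl
  map_smul' _ _ := rfl

theorem coords_injective (n : ℕ) : Function.Injective (coords n) := fun v w h => by
  ext k
  exact congrFun h k

theorem mem_permutohedron_iff {n : ℕ} {P : ℕ → ℝ} (hP : IsConcave P) (h0 : P 0 = 0)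
    {v : E n} (hv : ∀ k : Fin (n + 1), v.1 k = P (k + 1) - P k) (w : E n) :
    w ∈ permutohedron n v ↔ coords n w ∈ majPolytope n P := by
  have himage : coords n '' weylOrbit n v = rearrangements n P := by
    ext y
    constructor
    · rintro ⟨w, ⟨σ, hσ⟩, rfl⟩
      exact ⟨σ, fun i => (hσ i).trans (hv _)⟩
    · rintro ⟨σ, hσ⟩
      have hsum : ∑ k, v.1 k = 0 := v.2
      refine ⟨⟨WithLp.toLp 2 y, ?_⟩, ⟨σ, fun i => (hσ i).trans (hv _).symm⟩, rfl⟩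
      change ∑ k, y k = 0
      rw [← hsum, ← Equiv.sum_comp σ fun k => v.1 k]
      exact sum_congr rfl fun k _ => (hσ k).trans (hv _).symm
  rw [← convexHull_rearrangements hP h0, ← himage, ← LinearMap.image_convexHull,
    (coords_injective n).mem_set_image, permutohedron]

theorem permutohedron_eq_preimage {n : ℕ} {P : ℕ → ℝ} (hP : IsConcave P) (h0 : P 0 = 0)
    (hn : P (n + 1) = 0) {v : E n} (hv : ∀ k : Fin (n + 1), v.1 k = P (k + 1) - P k) :
    permutohedron n v = dropLast n ⁻¹' projPolytope n P := by
  ext w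
  rw [mem_permutohedron_iff hP h0 hv, Set.mem_preimage, projPolytope, Set.mem_ofPred_eq, hn]
  have : coords n ((dropLast n).symm (dropLast n w)) =
      (Fin.snoc (dropLast n w) (0 - ∑ i, dropLast n w i) : Fin (n + 1) → ℝ) := by
    rw [zero_sub]
    rfl
  rw [← this, LinearEquiv.symm_apply_apply]

theorem isVolumePolynomial_dyckSum (n : ℕ) : IsVolumePolynomial n (dyckSum n) := by
  intro x hx
  have h0 := weightSums_zero n x
  have hP := isConcave_weightSums hx
  obtain ⟨hnn, hvol⟩ := volume_projPolytope (n := n) hP h0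
  rw [permutohedron_eq_preimage hP h0 (weightSums_succ_self n x) (coe_sum_fundamentalWeight n x),
    vol_preimage_dropLast, hvol, ← ENNReal.ofReal_mul (Real.sqrt_nonneg _),
    ENNReal.toReal_ofReal (by positivity), ← mul_assoc,
    eval_dyckSum (P := weightSums n x) (a := 0) fun j hj => by
      simp only [zero_add, secondDiff_weightSums, if_pos hj], zero_add]

theorem IsVolumePolynomial.unique {n : ℕ} {V W : MvPolynomial ℕ ℝ} (hV : IsVolumePolynomial n V)
    (hW : IsVolumePolynomial n W) : V = W := by
  -- Requiring all variables to be nonnegative, not just the first `n`, makes the test points a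
  -- product of infinite sets.
  refine MvPolynomial.funext_set (fun _ => Set.Ici (0 : ℝ)) (fun _ => Set.Ici_infinite 0)
    fun x hx => ?_
  have hx' : ∀ j < n, 0 ≤ x j := fun j _ => hx j (Set.mem_univ j)
  rw [hV x hx', hW x hx']

end Permutohedron

end

theorem theorem3 (n : ℕ) :
    (∃! V : MvPolynomial ℕ ℝ, Permutohedron.IsVolumePolynomial n V) ∧
      ∀ V : MvPolynomial ℕ ℝ, Permutohedron.IsVolumePolynomial n V →
        V = ∑ D : Permutohedron.DyckPath n, Permutohedron.gammaPath D :=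
  ⟨⟨_, Permutohedron.isVolumePolynomial_dyckSum n,
      fun _ hV => hV.unique (Permutohedron.isVolumePolynomial_dyckSum n)⟩,
    fun _ hV => hV.unique (Permutohedron.isVolumePolynomial_dyckSum n)⟩
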